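/- **Model.** A network is a finite directed graph $(\mathcal V,\mathcal E)$ with processing capacities $C_i>0$ at the nodes and transmission capacities $C_{ij}>0$ on the links (per time slot), and sets $\mathcal V(k)\subseteq\mathcal V$ of nodes that cache database $k$. There are finitely many clients $c=(s,d,\phi)$ with source $s$, destination $d$ and service $\phi$. Service $\phi$ needs database $k_\phi$; per live packet it consumes $\zeta_\phi\ge0$ static packets and $r_\phi\ge0$ units of processing, and produces $\xi_\phi\ge0$ output packets. The augmented layered graph of $\phi$ has the nodes $i_1,i_1',i_2$ $(i\in\mathcal V)$ and $o_1'$, and the edges $(i_1,j_1),(i_1',j_1'),(i_2,j_2)$ for $(i,j)\in\mathcal E$, $(i_1,i_2),(i_1',i_2)$ for $i\in\mathcal V$, and $(o_1',v_1')$ for $v\in\mathcal V(k_\phi)$. A route of client $c$ consists of a processing node $p$, walks from $s_1$ to $p_1$, from $o_1'$ to $p_1'$ and from $p_2$ to $d_2$ in this graph (for the live, static and output packet), and the edges $(p_1,p_2),(p_1',p_2)$. $\mathcal F_c$ is the finite set of those routes whose three walks are acyclic. For each client $c$ the numbers of live packets arriving in the slots are i.i.d. over time and bounded, with mean $\lambda^{(c)}\ge0$.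 A (possibly randomized) causal policy assigns a route to every arriving request, and schedules in each slot the service of the queued packets within the capacities; service of a packet may extend over several slots. The live packet (size $1$) and the static packet (size $\zeta_\phi$) move along their walks hop by hop and wait for each other at $p$; when both are there they are processed jointly ($r_\phi$ units of work), and then the output packet (size $\xi_\phi$) moves to $d$. Scheduling is distributed if the decision of each node or link depends only on the present and past content of its own queue (and a random seed independent of the arrivals). A policy stabilizes the queues if almost surely $Q(t)/t\to0$ for the number $Q(t)$ of packets in every transmission, processing and waiting queue. The stability region $\Lambda\subseteq[0,\infty)^{\text{clients}}$ is the set of all $\lambda$ for which some policy with distributed scheduling stabilizes the queues for all arrival processes with mean $\lambda$. **Theorem 1.** Let $$\rho_i^{(c,\sigma)}=r_\phi\mathbf 1_{\{(i_1,i_2)\in\sigma\}},\qquad \rho_{ij}^{(c,\sigma)}=\mathbf 1_{\{(i_1,j_1)\in\sigma\}}+\zeta_\phi\mathbf 1_{\{(i_1',j_1')\in\sigma\}}+\xi_\phi\mathbf 1_{\{(i_2,j_2)\in\sigma\}}.$$ An arrival vector $\lambda$ belongs to $\Lambda$ if and only if for each client $c$ there is a probability distribution $\mathbb P_c$ on $\mathcal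 F_c$ such that for all $i\in\mathcal V$ and $(i,j)\in\mathcal E$ $$\sum_{c,\sigma}\lambda^{(c)}\rho_i^{(c,\sigma)}\mathbb P_c(\sigma)\le C_i,\qquad \sum_{c,\sigma}\lambda^{(c)}\rho_{ij}^{(c,\sigma)}\mathbb P_c(\sigma)\le C_{ij}.$$ Moreover, $\lambda$ is in the topological interior of $\Lambda$ relative to $[0,\infty)^{\text{clients}}$ if and only if such distributions exist with all these inequalities strict. Finally, if for at least one arrival process with mean $\lambda$ some causal policy (its scheduling need not be distributed) stabilizes the queues, then $\lambda\in\Lambda$. -/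

import Mathlib

open MeasureTheory ProbabilityTheory Filter Topology
open scoped NNReal Classical

noncomputable section

namespace EdgeCloud

/-- A cache-enabled edge network with node set `V`, together with the services `Φ` offered on it,
the databases `K` stored in it and the clients `C` it serves. -/
structure Network (V Φ K C : Type*) where
  /-- the directed graph of the communication links -/
  graph : Digraph V
  /-- `C_i`: processing instructions that node `i` can execute per slot -/
  nodeCap : V → ℝ
  /-- `C_ij`: data units that link `(i, j)` can transmit per slot -/
  linkCap : V → V → ℝ
  /-- `V(k)`: the nodes that cache database `k` -/
  staticSources : K → Set V
  /-- `ξ_φ`: output packets per live packet -/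
  scaling : Φ → ℝ
  /-- `r_φ`: instructions needed to process one live packet -/
  workload : Φ → ℝ
  /-- `k_φ`: the database that the service needs -/
  object : Φ → K
  /-- `ζ_φ`: static packets per live packet -/
  merging : Φ → ℝ
  /-- the source node of a client -/
  src : C → V
  /-- the destination node of a client -/
  dst : C → V
  /-- the service that a client requests -/
  service : C → Φ
  nodeCap_pos : ∀ i, 0 < nodeCap i
  linkCap_pos : ∀ i j, graph.Adj i j → 0 < linkCap i j
  scaling_nonneg : ∀ φ, 0 ≤ scaling φ
  workload_nonneg : ∀ φ, 0 ≤ workload φ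
  merging_nonneg : ∀ φ, 0 ≤ merging φ

/-- Nodes of the augmented layered graph: `live i` is `i₁`, `static i` is `i₁'`, `output i` is
`i₂`, and `superSource` is `o₁'`. -/
inductive ALGNode (V : Type*) where
  | live (i : V)
  | static (i : V)
  | output (i : V)
  | superSource

/-- The three pipelines. -/
inductive Pipeline where
  | live
  | static
  | output

/-- The places where packets are queued for service: processors and links. -/
inductive Resource (V : Type*) where
  | node (i : V)
  | link (i j : V)

/-- The tasks of a packet-level request: crossing the `k`-th edge of the path in a pipeline, and
processing the pair of live and static packets. -/
inductive Task where
  | hop (x : Pipeline) (k : ℕ)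
  | proc

namespace Network

variable {V Φ K C : Type*} (N : Network V Φ K C)

/-- The augmented layered graph of service `φ`. -/
def alg (φ : Φ) : Digraph (ALGNode V) where
  Adj
    | .live i, .live j => N.graph.Adj i j
    | .static i, .static j => N.graph.Adj i j
    | .output i, .output j => N.graph.Adj i j
    | .live i, .output j => i = j
    | .static i, .output j => i = j
    | .superSource, .static v => v ∈ N.staticSources (N.object φ)
    | _, _ => False

/-- `l` is the list of nodes of a walk from `x` to `y` in the augmented layered graph. -/
structure IsWalk (φ : Φ) (l : List (ALGNode V)) (x y : ALGNode V) : Prop where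
  chain : l.IsChain (N.alg φ).Adj
  head : l.head? = some x
  last : l.getLast? = some y

/-- A route for a request of client `c`: a processing location and three walks, for the live, the
static and the output packets. -/
structure Route (c : C) where
  proc : V
  path : Pipeline → List (ALGNode V)
  live_walk : N.IsWalk (N.service c) (path .live) (.live (N.src c)) (.live proc)
  static_walk : N.IsWalk (N.service c) (path .static) .superSource (.static proc)
  output_walk : N.IsWalk (N.service c) (path .output) (.output proc) (.output (N.dst c))

variable {N}

/-- The successive edges of the walk in pipeline `x`. -/
def Route.steps {c : C} (σ : N.Route c) (x : Pipeline) : List (ALGNode V × ALGNode V) :=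
  (σ.path x).zip (σ.path x).tail

/-- All edges of the augmented layered graph that a route contains. -/
def Route.edges {c : C} (σ : N.Route c) : Set (ALGNode V × ALGNode V) :=
  {e | (∃ x, e ∈ σ.steps x) ∨ e = (.live σ.proc, .output σ.proc) ∨
    e = (.static σ.proc, .output σ.proc)}

variable (N)

/-- `F_c`: the routes of client `c` whose three walks are acyclic. -/
def Star (c : C) : Type _ :=
  {σ : N.Route c // ∀ x, (σ.path x).Nodup}

instance instFiniteALGNode [Finite V] : Finite (ALGNode V) := by
  refine Finite.of_injective
    (β := V ⊕ V ⊕ V ⊕ Unit)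
    (fun x => match x with
      | .live i => .inl i
      | .static i => .inr (.inl i)
      | .output i => .inr (.inr (.inl i))
      | .superSource => .inr (.inr (.inr ()))) ?_
  intro x y h
  cases x <;> cases y <;> simp_all

instance instFinitePipeline : Finite Pipeline := by
  refine Finite.of_injective
    (β := Fin 3) (fun x => match x with
      | .live => 0
      | .static => 1
      | .output => 2) ?_
  intro x y h
  cases x <;> cases y <;> simp_all

instance instFiniteStar [Finite V] (c : C) : Finite (N.Star c) := by
  have : Fintype (ALGNode V) := Fintype.ofFinite _
  have : Finite {l : List (ALGNode V) // l.Nodup} := Finite.of_fintype _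
  refine Finite.of_injective
    (β := V × (Pipeline → {l : List (ALGNode V) // l.Nodup}))
    (fun σ => (σ.1.proc, fun x => ⟨σ.1.path x, σ.2 x⟩)) ?_
  rintro ⟨⟨p, f, _, _, _⟩, hf⟩ ⟨⟨q, g, _, _, _⟩, hg⟩ h
  simp only [Prod.mk.injEq] at h
  obtain ⟨rfl, h⟩ := h
  have : f = g := by
    funext x
    exact congrArg Subtype.val (congrFun h x)
  subst this
  rfl

instance instFintypeStar [Finite V] (c : C) : Fintype (N.Star c) := Fintype.ofFinite _

variable {N}

/-- `ρ_i^(c,σ)`: the processing load of a route on node `i`. -/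
def Route.nodeLoad {c : C} (σ : N.Route c) (i : V) : ℝ :=
  N.workload (N.service c) * (if (.live i, .output i) ∈ σ.edges then 1 else 0)

/-- `ρ_ij^(c,σ)`: the transmission load of a route on link `(i, j)`. -/
def Route.linkLoad {c : C} (σ : N.Route c) (i j : V) : ℝ :=
  (if (.live i, .live j) ∈ σ.edges then 1 else 0)
    + N.merging (N.service c) * (if (.static i, .static j) ∈ σ.edges then 1 else 0)
    + N.scaling (N.service c) * (if (.output i, .output j) ∈ σ.edges then 1 else 0)

variable (N)

/-! ### The actual queueing network -/

/-- The resource that operates an edge of the augmented layered graph. Replication at a static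
source needs none, and the operation of a processor on a pair of packets is attached to the
inter-layer edge of the live packet. -/
def edgeResource : ALGNode V × ALGNode V → Option (Resource V)
  | (.live i, .live j) => some (.link i j)
  | (.static i, .static j) => some (.link i j)
  | (.output i, .output j) => some (.link i j)
  | (.live i, .output _) => some (.node i)
  | _ => none

/-- The amount of service (data units or instructions) needed to push the packet of one request
through an edge. The static and the output packet of a request stand for `ζ` and `ξ` data units. -/
def edgeWork (φ : Φ) : ALGNode V × ALGNode V → ℝ
  | (.live _, .live _) => 1
  | (.static _, .static _) => N.merging φ
  | (.output _, .output _) => N.scaling φ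
  | (.live _, .output _) => N.workload φ
  | _ => 0

variable {N}

/-- The edge that a task crosses (none, if the index lies beyond the end of the path). -/
def Route.taskEdge {c : C} (σ : N.Route c) : Task → Option (ALGNode V × ALGNode V)
  | .hop x k => (σ.steps x)[k]?
  | .proc => some (.live σ.proc, .output σ.proc)

def Route.taskResource {c : C} (σ : N.Route c) (w : Task) : Option (Resource V) :=
  (σ.taskEdge w).bind edgeResource

def Route.taskWork {c : C} (σ : N.Route c) (w : Task) : ℝ :=
  ((σ.taskEdge w).map (N.edgeWork (N.service c))).getD 0

/-- The tasks that a request with route `σ` consists of. -/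
def Route.tasks {c : C} (σ : N.Route c) : Finset Task :=
  insert .proc
    ((Finset.range (σ.steps .live).length).image (Task.hop .live) ∪
      (Finset.range (σ.steps .static).length).image (Task.hop .static) ∪
      (Finset.range (σ.steps .output).length).image (Task.hop .output))

variable (N)

/-- A sample path of control decisions. The request `(c, τ, n)` is the `n`-th live packet of client
`c` that arrives in slot `τ`. It gets the route `route c τ n`, and in slot `t` its task `w` is given
the amount `serve t c τ n w` of service. -/
structure Control where
  route : (c : C) → ℕ → ℕ → N.Route c
  serve : ℕ → C → ℕ → ℕ → Task → ℝ

variable {N}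

namespace Control

variable (u : N.Control)

/-- The service that a task has received before slot `t`. -/
def received (t : ℕ) (c : C) (τ n : ℕ) (w : Task) : ℝ :=
  ∑ s ∈ Finset.range t, u.serve s c τ n w

/-- The task has received all the service it needs before slot `t`. -/
def Finished (t : ℕ) (c : C) (τ n : ℕ) (w : Task) : Prop :=
  (u.route c τ n).taskWork w ≤ u.received t c τ n w

/-- The packet in pipeline `x` has crossed the first `k` edges of its path before slot `t`. -/
def Crossed (t : ℕ) (c : C) (τ n : ℕ) (x : Pipeline) (k : ℕ) : Prop :=
  ∀ j < k, u.Finished t c τ n (.hop x j)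

/-- The packet in pipeline `x` has reached the end of its path before slot `t`. -/
def AtEnd (t : ℕ) (c : C) (τ n : ℕ) (x : Pipeline) : Prop :=
  u.Crossed t c τ n x ((u.route c τ n).steps x).length

/-- Precedence: packets move hop by hop, live and static packet have to meet before they are
processed, and the output packet exists only after processing. -/
def Ready (t : ℕ) (c : C) (τ n : ℕ) : Task → Prop
  | .hop .live k => u.Crossed t c τ n .live k
  | .hop .static k => u.Crossed t c τ n .static k
  | .proc => u.AtEnd t c τ n .live ∧ u.AtEnd t c τ n .static
  | .hop .output k => u.AtEnd t c τ n .live ∧ u.AtEnd t c τ n .static ∧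
      u.Finished t c τ n .proc ∧ u.Crossed t c τ n .output k

/-- In slot `t` the request `(c, τ, n)` has a packet (for `proc`: a pair of packets) in the queue
of the resource that performs task `w`. -/
def Pending (t : ℕ) (c : C) (τ n : ℕ) (w : Task) : Prop :=
  τ ≤ t ∧ w ∈ (u.route c τ n).tasks ∧ u.Ready t c τ n w ∧ ¬ u.Finished t c τ n w

/-- The service that resource `e` spends in slot `t`, if `α τ c` live packets of client `c` arrive
in slot `τ`. -/
def spent [Fintype C] (α : ℕ → C → ℕ) (e : Resource V) (t : ℕ) : ℝ :=
  ∑ c, ∑ τ ∈ Finset.range (t + 1), ∑ n ∈ Finset.range (α τ c),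
    ∑ w ∈ (u.route c τ n).tasks with (u.route c τ n).taskResource w = some e,
      u.serve t c τ n w

/-- The decisions respect the precedence constraints and all capacities. -/
structure Admissible [Fintype C] (α : ℕ → C → ℕ) : Prop where
  nonneg : ∀ t c τ n w, 0 ≤ u.serve t c τ n w
  pending : ∀ t c τ n w, u.serve t c τ n w ≠ 0 → u.Pending t c τ n w
  node_le : ∀ t i, u.spent α (.node i) t ≤ N.nodeCap i
  link_le : ∀ t i j, N.graph.Adj i j → u.spent α (.link i j) t ≤ N.linkCap i j

/-- The number of packets in the transmission queue of a link, or of pairs of packets in the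
processing queue of a node, in slot `t`. -/
def queue [Fintype C] (α : ℕ → C → ℕ) (e : Resource V) (t : ℕ) : ℕ :=
  ∑ c, ∑ τ ∈ Finset.range (t + 1), ∑ n ∈ Finset.range (α τ c),
    ((u.route c τ n).tasks.filter fun w =>
      (u.route c τ n).taskResource w = some e ∧ u.Pending t c τ n w).card

/-- The number of packets in the waiting queue of node `i` in slot `t`: live or static packets that
have reached `i` for processing, and whose associate has not. -/
def waitingQueue [Fintype C] (α : ℕ → C → ℕ) (i : V) (t : ℕ) : ℕ :=
  ∑ c, ∑ τ ∈ Finset.range (t + 1), ((Finset.range (α τ c)).filter fun n =>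
    (u.route c τ n).proc = i ∧ Xor (u.AtEnd t c τ n .live) (u.AtEnd t c τ n .static)).card

/-- Rate stability of all actual queues. -/
def RateStable [Fintype C] (α : ℕ → C → ℕ) : Prop :=
  (∀ e, Tendsto (fun t : ℕ => (u.queue α e t : ℝ) / t) atTop (𝓝 0)) ∧
    ∀ i, Tendsto (fun t : ℕ => (u.waitingQueue α i t : ℝ) / t) atTop (𝓝 0)

end Control

variable (N)

/-- A packet in a queue, with what its header tells: the request it belongs to, the task it waits
for, its route, and the service received so far for that task. -/
structure QueuedPacket where
  client : C
  slot : ℕ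
  idx : ℕ
  task : Task
  route : N.Route client
  received : ℝ

variable {N}

/-- The content of the queue of resource `e` in slot `t`. -/
def Control.localQueue (u : N.Control) (α : ℕ → C → ℕ) (e : Resource V) (t : ℕ) :
    Set N.QueuedPacket :=
  {p | p.idx < α p.slot p.client ∧ p.route = u.route p.client p.slot p.idx ∧
    p.received = u.received t p.client p.slot p.idx p.task ∧
    u.Pending t p.client p.slot p.idx p.task ∧ p.route.taskResource p.task = some e}

variable (N)

/-- A (possibly randomized) control policy: in each slot, the routes of the newly arrived requests
and the service of the packets are determined by the arrivals up to that slot and by a random seed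
that is independent of the arrivals. -/
structure Policy [Fintype C] where
  Seed : Type
  [seedSpace : MeasurableSpace Seed]
  seedLaw : Measure Seed
  [seedProb : IsProbabilityMeasure seedLaw]
  control : (ℕ → C → ℕ) → Seed → N.Control
  admissible : ∀ α θ, (control α θ).Admissible α
  causal_route : ∀ α α' θ t, (∀ s ≤ t, α s = α' s) →
    ∀ c n, (control α θ).route c t n = (control α' θ).route c t n
  causal_serve : ∀ α α' θ t, (∀ s ≤ t, α s = α' s) →
    ∀ c τ n w, (control α θ).serve t c τ n w = (control α' θ).serve t c τ n w
  measurable_route : ∀ α c t n σ, MeasurableSet {θ | (control α θ).route c t n = σ}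
  measurable_serve : ∀ α t c τ n w, Measurable fun θ => (control α θ).serve t c τ n w

attribute [instance] Policy.seedSpace Policy.seedProb

variable {N}

/-- Distributed scheduling: what a node or link does in a slot depends only on the current and past
content of its own queue (and on the seed). -/
def Policy.IsDistributed [Fintype C] (π : N.Policy) : Prop :=
  ∀ θ α α' t e,
    (∀ s ≤ t, (π.control α θ).localQueue α e s = (π.control α' θ).localQueue α' e s) →
    ∀ p ∈ (π.control α θ).localQueue α e t,
      (π.control α θ).serve t p.client p.slot p.idx p.task =
        (π.control α' θ).serve t p.client p.slot p.idx p.task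

end Network

/-- `a t c` live packets of client `c` arrive in slot `t`. For each client, the arrivals are
i.i.d. over time, bounded, and have mean `lam c`. -/
structure IsArrivalProcess {C Ω : Type*} [MeasurableSpace Ω] (P : Measure Ω)
    (a : ℕ → C → Ω → ℕ) (lam : C → ℝ≥0) : Prop where
  measurable : ∀ t c, Measurable (a t c)
  indep : ∀ c, iIndepFun (fun t => a t c) P
  ident : ∀ t c, IdentDistrib (a t c) (a 0 c) P P
  bounded : ∀ c, ∃ A : ℕ, ∀ t, ∀ᵐ ω ∂P, a t c ω ≤ A
  mean : ∀ t c, ∫ ω, (a t c ω : ℝ) ∂P = lam c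

namespace Network

variable {V Φ K C : Type*} [Fintype C] {N : Network V Φ K C}

/-- With probability one, all actual queues are rate stable under the policy. -/
def Policy.Stabilizes (π : N.Policy) {Ω : Type*} [MeasurableSpace Ω] (P : Measure Ω)
    (a : ℕ → C → Ω → ℕ) : Prop :=
  ∀ᵐ x ∂(P.prod π.seedLaw),
    (π.control (fun t c => a t c x.1) x.2).RateStable (fun t c => a t c x.1)

variable (N)

/-- The network stability region `Λ`: the arrival-rate vectors for which some policy with
distributed scheduling stabilizes the queues. -/
def stabilityRegion : Set (C → ℝ≥0) :=
  {lam | ∃ π : N.Policy, π.IsDistributed ∧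
    ∀ (Ω : Type) [MeasurableSpace Ω] (P : Measure Ω) [IsProbabilityMeasure P]
      (a : ℕ → C → Ω → ℕ), IsArrivalProcess P a lam → π.Stabilizes P a}

/-- `P c` is a probability distribution on the acyclic routes of client `c`, for every `c`. -/
def IsRouteDistribution [Finite V] (P : (c : C) → N.Star c → ℝ) : Prop :=
  ∀ c, (∀ σ, 0 ≤ P c σ) ∧ ∑ σ, P c σ = 1

/-- The average load on node `i`. -/
def avgNodeLoad [Finite V] (lam : C → ℝ≥0) (P : (c : C) → N.Star c → ℝ) (i : V) : ℝ :=
  ∑ c, ∑ σ, (lam c : ℝ) * σ.1.nodeLoad i * P c σ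

/-- The average load on link `(i, j)`. -/
def avgLinkLoad [Finite V] (lam : C → ℝ≥0) (P : (c : C) → N.Star c → ℝ) (i j : V) : ℝ :=
  ∑ c, ∑ σ, (lam c : ℝ) * σ.1.linkLoad i j * P c σ

end Network

end EdgeCloud

end

/-! Sufficiency holds even when loads equal capacities, because only rate stability is asked. Every
resource dedicates the rate `lam c * P c σ`, in packets per slot and per task, to the requests of
client `c` on route `σ`; the load inequalities say that these rates fit. Routes follow a
deterministic sequence of bounded discrepancy (`exists_balanced_sequence`), so by the strong law
each class of requests arrives at the rate dedicated to it. Precedence turns the tasks of a class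
into an acyclic system of stations, and induction along it shows that every station works at the
arrival rate in the long run (`tendsto_level_div`). A backlog is thus a difference of two sequences
of equal rate, which is `o(t)`. The control is distributed because the service of a packet depends
only on its position in its class, on the number of queued packets of the class and on the partial
service of the first of them; all three can be read off the local queue
(`serve_eq_of_localQueue_eq`).

Necessity is an argument on a single sample path. An incomplete request has a packet in some queue,
so all but `o(T)` requests are completed by time `T`, and the service spent covers their work.
Replacing each route by an acyclic one contained in it does not increase the loads. The frequencies
of the resulting routes stay in a compact box, and a limit point is the required distribution, up to
the factor `lam c` (`sum_mul_resourceLoad_le_of_tendsto`). One arrival process and one causal policy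
suffice for this, which gives the last claim; for the stability region itself, an arrival process
with the given mean has to exist (`exists_isArrivalProcess`).

For the interior, strict inequalities persist nearby by continuity. Conversely, a point of the
interior remains in the region when all rates are raised by some `ε > 0`, and this leaves slack at
each resource (`avg_lt_of_add_le`). -/

noncomputable section

namespace EdgeCloud

/-! ### Walks -/

/-- Every walk contains an acyclic walk with the same ends, all of whose edges it contains. -/
theorem exists_nodup_isChain {α : Type*} {R : α → α → Prop} {y : α} :
    ∀ (l : List α) (x : α), (x :: l).IsChain R → (x :: l).getLast? = some y →
      ∃ m : List α, (x :: m).IsChain R ∧ (x :: m).getLast? = some y ∧ (x :: m).Nodup ∧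
        ∀ e ∈ (x :: m).zip m, e ∈ (x :: l).zip l := by
  intro l
  induction l with
  | nil => exact fun x _ hy => ⟨[], by simp, hy, by simp, by simp⟩
  | cons z l ih =>
    intro x hc hy
    rw [List.isChain_cons_cons] at hc
    obtain ⟨m, hm, hmy, hmn, hme⟩ := ih z hc.2 (by simpa using hy)
    by_cases hx : x ∈ z :: m
    -- Loop erasure: if `x` recurs on the shortened walk, everything before that occurrence is
    -- dropped.
    · obtain ⟨s, t, hst⟩ := List.append_of_mem hx
      have hsuf : (x :: t) <:+ (z :: m) := ⟨s, hst.symm⟩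
      refine ⟨t, hm.suffix hsuf, ?_, hmn.sublist hsuf.sublist, ?_⟩
      · rw [← hmy, hst, List.getLast?_append]; simp [List.getLast?_cons]
      · intro e he
        have : e ∈ (z :: m).zip m := by
          rcases s with _ | ⟨z', s⟩
          · simp only [List.nil_append, List.cons.injEq] at hst
            obtain ⟨rfl, rfl⟩ := hst
            exact he
          · simp only [List.cons_append, List.cons.injEq] at hst
            obtain ⟨rfl, rfl⟩ := hst
            clear * - he
            induction s generalizing z with
            | nil => simp [he]
            | cons b s ih => exact List.mem_cons_of_mem _ (ih b)
        exact List.mem_cons_of_mem _ (hme e this)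
    · refine ⟨z :: m, ?_, by simpa using hmy, List.nodup_cons.2 ⟨hx, hmn⟩, ?_⟩
      · exact List.isChain_cons_cons.2 ⟨hc.1, hm⟩
      · intro e he
        rw [List.zip_cons_cons, List.mem_cons] at he ⊢
        exact he.imp_right (hme e)

theorem adj_of_mem_zip_tail {α : Type*} {R : α → α → Prop} :
    ∀ {l : List α}, l.IsChain R → ∀ e ∈ l.zip l.tail, R e.1 e.2
  | [], _, e, he => by simp at he
  | [a], _, e, he => by simp at he
  | a :: b :: l, h, e, he => by
    rw [List.isChain_cons_cons] at h
    simp only [List.tail_cons, List.zip_cons_cons, List.mem_cons] at he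
    rcases he with rfl | he
    · exact h.1
    · exact adj_of_mem_zip_tail h.2 e he

theorem nodup_zip_tail {α : Type*} {l : List α} (h : l.Nodup) : (l.zip l.tail).Nodup := by
  refine List.Nodup.of_map Prod.snd ?_
  rw [List.map_snd_zip (by simp)]
  exact h.sublist (List.tail_sublist l)

/-- Sum of a function that vanishes except at one value. -/
theorem sum_map_eq_count {α : Type*} [BEq α] [LawfulBEq α] {l : List α} {f : α → ℝ}
    (x : α) (v : ℝ) (h : ∀ e ∈ l, f e = if e = x then v else 0) :
    (l.map f).sum = l.count x * v := by
  induction l with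
  | nil => simp
  | cons a l ih =>
    rw [List.map_cons, List.sum_cons, ih fun e he => h e (List.mem_cons_of_mem _ he),
      List.count_cons, h a List.mem_cons_self]
    by_cases hx : a = x <;> simp [hx]; ring

theorem sum_range_getElem? {α : Type*} (G : α → ℝ) (l : List α) :
    ∑ k ∈ Finset.range l.length, ((l[k]?).map G).getD 0 = (l.map G).sum := by
  induction l with
  | nil => simp
  | cons a l ih =>
    rw [List.length_cons, Finset.sum_range_succ', List.map_cons, List.sum_cons, ← ih]
    simp [add_comm]

namespace Network

variable {V Φ K C : Type*} {N : Network V Φ K C}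

theorem IsWalk.exists_nodup {φ : Φ} {l : List (ALGNode V)} {x y : ALGNode V}
    (h : N.IsWalk φ l x y) :
    ∃ m, N.IsWalk φ m x y ∧ m.Nodup ∧ ∀ e ∈ m.zip m.tail, e ∈ l.zip l.tail := by
  obtain ⟨hc, hx, hy⟩ := h
  cases l with
  | nil => simp at hx
  | cons z l =>
    obtain rfl : z = x := by simpa using hx
    obtain ⟨m, h1, h2, h3, h4⟩ := exists_nodup_isChain l z hc hy
    exact ⟨z :: m, ⟨h1, by simp, h2⟩, h3, h4⟩

theorem IsWalk.mem_backwards {φ : Φ} {l : List (ALGNode V)} {x y : ALGNode V}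
    (h : N.IsWalk φ l x y) (Q : ALGNode V → Prop) (hy : Q y)
    (hQ : ∀ a b, (N.alg φ).Adj a b → Q b → Q a) : ∀ z ∈ l, Q z := by
  have := h.chain.backwards_induction Q l (fun {a b} hab hb => hQ a b hab hb)
  refine this fun hl => ?_
  have h2 := h.last
  rw [List.getLast?_eq_some_getLast hl] at h2
  rw [Option.some.inj h2]; exact hy

theorem IsWalk.mem_forwards {φ : Φ} {l : List (ALGNode V)} {x y : ALGNode V}
    (h : N.IsWalk φ l x y) (Q : ALGNode V → Prop) (hx : Q x)
    (hQ : ∀ a b, (N.alg φ).Adj a b → Q a → Q b) : ∀ z ∈ l, Q z := by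
  have := h.chain.induction Q l (fun {a b} hab hb => hQ a b hab hb)
  refine this fun hl => ?_
  have h2 := h.head
  rw [List.head?_eq_some_head hl] at h2
  rw [Option.some.inj h2]; exact hx

/-! ### Layers, tasks and loads of a route -/

namespace Route

variable {c : C} (σ : N.Route c)

/-- Live nodes are entered only from live nodes, so a walk that ends in the live layer never left
it. For the output layer the argument runs forwards, since it cannot be left. -/
theorem eq_of_mem_steps_live {e : ALGNode V × ALGNode V} (he : e ∈ σ.steps .live) :
    ∃ i j, N.graph.Adj i j ∧ e = (.live i, .live j) := by
  have hQ := σ.live_walk.mem_backwards (fun z => ∃ i, z = .live i) ⟨_, rfl⟩ (by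
    rintro a _ hab ⟨j, rfl⟩
    cases a <;> simp_all [alg])
  have had := adj_of_mem_zip_tail σ.live_walk.chain e he
  obtain ⟨x, y⟩ := e
  obtain ⟨i, rfl⟩ := hQ x (List.of_mem_zip he).1
  obtain ⟨j, rfl⟩ := hQ y (List.mem_of_mem_tail (List.of_mem_zip he).2)
  exact ⟨i, j, had, rfl⟩

theorem eq_of_mem_steps_output {e : ALGNode V × ALGNode V} (he : e ∈ σ.steps .output) :
    ∃ i j, N.graph.Adj i j ∧ e = (.output i, .output j) := by
  have hQ := σ.output_walk.mem_forwards (fun z => ∃ i, z = .output i) ⟨_, rfl⟩ (by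
    rintro _ b hab ⟨j, rfl⟩
    cases b <;> simp_all [alg])
  have had := adj_of_mem_zip_tail σ.output_walk.chain e he
  obtain ⟨x, y⟩ := e
  obtain ⟨i, rfl⟩ := hQ x (List.of_mem_zip he).1
  obtain ⟨j, rfl⟩ := hQ y (List.mem_of_mem_tail (List.of_mem_zip he).2)
  exact ⟨i, j, had, rfl⟩

theorem eq_of_mem_steps_static {e : ALGNode V × ALGNode V} (he : e ∈ σ.steps .static) :
    (∃ i j, N.graph.Adj i j ∧ e = (.static i, .static j)) ∨ ∃ j, e = (.superSource, .static j) := by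
  have hQ := σ.static_walk.mem_backwards (fun z => (∃ i, z = .static i) ∨ z = .superSource)
    (.inl ⟨_, rfl⟩) (by
    rintro a b hab hb
    cases a <;> cases b <;> simp_all [alg])
  have had := adj_of_mem_zip_tail σ.static_walk.chain e he
  obtain ⟨x, y⟩ := e
  have hx := hQ x (List.of_mem_zip he).1
  have hy := hQ y (List.mem_of_mem_tail (List.of_mem_zip he).2)
  rcases hx with ⟨i, rfl⟩ | rfl <;> rcases hy with ⟨j, rfl⟩ | rfl
  · exact .inl ⟨i, j, had, rfl⟩
  · simp [alg] at had
  · exact .inr ⟨j, rfl⟩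
  · simp [alg] at had

theorem live_mem_edges {i j : V} :
    (.live i, .live j) ∈ σ.edges ↔ (.live i, .live j) ∈ σ.steps .live := by
  constructor
  · rintro (⟨x, hx⟩ | h | h)
    · cases x
      · exact hx
      · rcases σ.eq_of_mem_steps_static hx with ⟨_, _, _, h⟩ | ⟨_, h⟩ <;> simp at h
      · obtain ⟨_, _, _, h⟩ := σ.eq_of_mem_steps_output hx; simp at h
    · simp at h
    · simp at h
  · exact fun h => .inl ⟨_, h⟩

theorem static_mem_edges {i j : V} :
    (.static i, .static j) ∈ σ.edges ↔ (.static i, .static j) ∈ σ.steps .static := by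
  constructor
  · rintro (⟨x, hx⟩ | h | h)
    · cases x
      · obtain ⟨_, _, _, h⟩ := σ.eq_of_mem_steps_live hx; simp at h
      · exact hx
      · obtain ⟨_, _, _, h⟩ := σ.eq_of_mem_steps_output hx; simp at h
    · simp at h
    · simp at h
  · exact fun h => .inl ⟨_, h⟩

theorem output_mem_edges {i j : V} :
    (.output i, .output j) ∈ σ.edges ↔ (.output i, .output j) ∈ σ.steps .output := by
  constructor
  · rintro (⟨x, hx⟩ | h | h)
    · cases x
      · obtain ⟨_, _, _, h⟩ := σ.eq_of_mem_steps_live hx; simp at h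
      · rcases σ.eq_of_mem_steps_static hx with ⟨_, _, _, h⟩ | ⟨_, h⟩ <;> simp at h
      · exact hx
    · simp at h
    · simp at h
  · exact fun h => .inl ⟨_, h⟩

theorem live_output_mem_edges {i : V} : (.live i, .output i) ∈ σ.edges ↔ σ.proc = i := by
  constructor
  · rintro (⟨x, hx⟩ | h | h)
    · cases x
      · obtain ⟨_, _, _, h⟩ := σ.eq_of_mem_steps_live hx; simp at h
      · rcases σ.eq_of_mem_steps_static hx with ⟨_, _, _, h⟩ | ⟨_, h⟩ <;> simp at h
      · obtain ⟨_, _, _, h⟩ := σ.eq_of_mem_steps_output hx; simp at h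
    · simp at h; exact h.symm
    · simp at h
  · rintro rfl; exact .inr (.inl rfl)

/-- Each route contains an acyclic route with the same processing node. -/
theorem exists_star : ∃ ρ : N.Star c, ρ.1.proc = σ.proc ∧
    ∀ x, ∀ e ∈ ρ.1.steps x, e ∈ σ.steps x := by
  obtain ⟨l, hl, hl', hle⟩ := σ.live_walk.exists_nodup
  obtain ⟨s, hs, hs', hse⟩ := σ.static_walk.exists_nodup
  obtain ⟨o, ho, ho', hoe⟩ := σ.output_walk.exists_nodup
  refine ⟨⟨⟨σ.proc, fun x => match x with
    | .live => l
    | .static => s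
    | .output => o, hl, hs, ho⟩, ?_⟩, rfl, ?_⟩
  · rintro (_ | _ | _) <;> assumption
  · rintro (_ | _ | _) <;> assumption

/-! ### Tasks -/

theorem mem_tasks {w : Task} : w ∈ σ.tasks ↔
    w = .proc ∨ ∃ x, ∃ k < (σ.steps x).length, w = .hop x k := by
  simp only [tasks, Finset.mem_insert, Finset.mem_union, Finset.mem_image, Finset.mem_range]
  constructor
  · rintro (h | (⟨k, hk, rfl⟩ | ⟨k, hk, rfl⟩) | ⟨k, hk, rfl⟩)
    · exact .inl h
    all_goals exact .inr ⟨_, k, hk, rfl⟩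
  · rintro (h | ⟨_ | _ | _, k, hk, rfl⟩)
    · exact .inl h
    all_goals simp [hk]

theorem sum_tasks (g : Task → ℝ) : ∑ w ∈ σ.tasks, g w = g .proc
    + ∑ k ∈ Finset.range (σ.steps .live).length, g (.hop .live k)
    + ∑ k ∈ Finset.range (σ.steps .static).length, g (.hop .static k)
    + ∑ k ∈ Finset.range (σ.steps .output).length, g (.hop .output k) := by
  have inj : ∀ x, Function.Injective (Task.hop x) := fun x a b h => by injection h
  rw [tasks, Finset.sum_insert (by simp), Finset.sum_union, Finset.sum_union,
    Finset.sum_image (inj _).injOn, Finset.sum_image (inj _).injOn, Finset.sum_image (inj _).injOn]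
  · ring
  all_goals
    rw [Finset.disjoint_left]
    intro w
    simp only [Finset.mem_union, Finset.mem_image]
    grind

theorem taskWork_nonneg (w : Task) : 0 ≤ σ.taskWork w := by
  unfold taskWork
  rcases σ.taskEdge w with _ | ⟨a, b⟩
  · simp
  · cases a <;> cases b <;> simp [edgeWork, N.merging_nonneg, N.scaling_nonneg, N.workload_nonneg]

theorem mem_tasks_of_taskWork_ne_zero {w : Task} (h : σ.taskWork w ≠ 0) : w ∈ σ.tasks := by
  rw [mem_tasks]
  rcases w with ⟨x, k⟩ | _
  · refine .inr ⟨x, k, ?_, rfl⟩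
    by_contra hk
    exact h (by simp [taskWork, taskEdge, List.getElem?_eq_none (not_lt.1 hk)])
  · exact .inl rfl

/-- The edges that no resource operates are exactly those to which `edgeWork` gives zero by default,
so unfinished work always belongs to some queue. -/
theorem taskResource_ne_none {w : Task} (h : σ.taskWork w ≠ 0) : ∃ e, σ.taskResource w = some e := by
  rcases hw : σ.taskEdge w with _ | ⟨a, b⟩
  · simp [taskWork, hw] at h
  · cases a <;> cases b <;> simp [taskWork, taskResource, hw, edgeWork, edgeResource] at h ⊢

/-- The work that a route requires from a resource. -/
def resourceLoad (e : Resource V) : ℝ :=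
  ∑ w ∈ σ.tasks with σ.taskResource w = some e, σ.taskWork w

/-- The work that crossing an edge requires from a resource. -/
def edgeLoad (N : Network V Φ K C) (φ : Φ) (r : Resource V) (e : ALGNode V × ALGNode V) : ℝ :=
  if edgeResource e = some r then N.edgeWork φ e else 0

theorem resourceLoad_eq_sum_steps (r : Resource V) : σ.resourceLoad r =
    edgeLoad N (N.service c) r (.live σ.proc, .output σ.proc)
      + ((σ.steps .live).map (edgeLoad N (N.service c) r)).sum
      + ((σ.steps .static).map (edgeLoad N (N.service c) r)).sum
      + ((σ.steps .output).map (edgeLoad N (N.service c) r)).sum := by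
  have key : ∀ w, (if σ.taskResource w = some r then σ.taskWork w else 0)
      = ((σ.taskEdge w).map (edgeLoad N (N.service c) r)).getD 0 := by
    intro w
    unfold taskResource taskWork
    rcases σ.taskEdge w with _ | e
    · simp
    · simp [edgeLoad]
  rw [resourceLoad, Finset.sum_filter, Finset.sum_congr rfl (fun w _ => key w), sum_tasks]
  simp only [taskEdge, sum_range_getElem?]
  simp

/-- Each walk stays in one layer, so all its steps over `(i, j)` are the same edge. Counts with
multiplicity are needed because an arbitrary route may cross a link repeatedly. -/
theorem resourceLoad_link (i j : V) : σ.resourceLoad (.link i j) =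
    (σ.steps .live).count (.live i, .live j)
      + (σ.steps .static).count (.static i, .static j) * N.merging (N.service c)
      + (σ.steps .output).count (.output i, .output j) * N.scaling (N.service c) := by
  rw [resourceLoad_eq_sum_steps, sum_map_eq_count (.live i, .live j) 1,
    sum_map_eq_count (.static i, .static j) (N.merging (N.service c)),
    sum_map_eq_count (.output i, .output j) (N.scaling (N.service c))]
  · simp [edgeLoad, edgeResource]
  · intro e he
    obtain ⟨a, b, -, rfl⟩ := σ.eq_of_mem_steps_output he
    simp [edgeLoad, edgeResource, edgeWork]
  · intro e he
    obtain ⟨a, b, -, rfl⟩ | ⟨b, rfl⟩ := σ.eq_of_mem_steps_static he <;>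
    simp [edgeLoad, edgeResource, edgeWork]
  · intro e he
    obtain ⟨a, b, -, rfl⟩ := σ.eq_of_mem_steps_live he
    simp [edgeLoad, edgeResource, edgeWork]

theorem resourceLoad_node (i : V) : σ.resourceLoad (.node i) = σ.nodeLoad i := by
  -- No step of the three walks uses a processor; with value `0`, any edge can play the exceptional
  -- one.
  rw [resourceLoad_eq_sum_steps, sum_map_eq_count (.superSource, .superSource) 0,
    sum_map_eq_count (.superSource, .superSource) 0,
    sum_map_eq_count (.superSource, .superSource) 0]
  · simp [nodeLoad, live_output_mem_edges, edgeLoad, edgeResource, edgeWork]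
  · intro e he
    obtain ⟨a, b, -, rfl⟩ := σ.eq_of_mem_steps_output he
    simp [edgeLoad, edgeResource]
  · intro e he
    obtain ⟨a, b, -, rfl⟩ | ⟨b, rfl⟩ := σ.eq_of_mem_steps_static he <;>
    simp [edgeLoad, edgeResource]
  · intro e he
    obtain ⟨a, b, -, rfl⟩ := σ.eq_of_mem_steps_live he
    simp [edgeLoad, edgeResource]

theorem resourceLoad_nonneg (r : Resource V) : 0 ≤ σ.resourceLoad r :=
  Finset.sum_nonneg fun w _ => σ.taskWork_nonneg w

/-- On an acyclic walk each edge occurs at most once, so multiplicities are indicators. -/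
theorem resourceLoad_star_link (ρ : N.Star c) (i j : V) :
    ρ.1.resourceLoad (.link i j) = ρ.1.linkLoad i j := by
  have hnd : ∀ x, (ρ.1.steps x).Nodup := fun x => nodup_zip_tail (ρ.2 x)
  have key : ∀ x e, ((ρ.1.steps x).count e : ℝ) = if e ∈ ρ.1.steps x then 1 else 0 := by
    intro x e
    split_ifs with h
    · rw [List.count_eq_one_of_mem (hnd x) h]; simp
    · rw [List.count_eq_zero_of_not_mem h]; simp
  rw [resourceLoad_link, linkLoad, key, key, key]
  simp only [live_mem_edges, static_mem_edges, output_mem_edges]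
  ring

theorem exists_star_resourceLoad_le :
    ∃ ρ : N.Star c, ∀ r, ρ.1.resourceLoad r ≤ σ.resourceLoad r := by
  obtain ⟨ρ, hp, hs⟩ := σ.exists_star
  refine ⟨ρ, fun r => ?_⟩
  rcases r with i | ⟨i, j⟩
  · simp [resourceLoad_node, nodeLoad, live_output_mem_edges, hp]
  · have hle : ∀ x e, ((ρ.1.steps x).count e : ℝ) ≤ (σ.steps x).count e := by
      intro x e
      have hnd : (ρ.1.steps x).Nodup := nodup_zip_tail (ρ.2 x)
      by_cases h : e ∈ ρ.1.steps x
      · rw [List.count_eq_one_of_mem hnd h]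
        exact_mod_cast List.one_le_count_iff.2 (hs x e h)
      · rw [List.count_eq_zero_of_not_mem h]; simp
    rw [resourceLoad_link, resourceLoad_link]
    have h1 := N.merging_nonneg (N.service c)
    have h2 := N.scaling_nonneg (N.service c)
    gcongr <;> exact_mod_cast hle _ _

/-- The tasks that have to be finished before a task can start. -/
def preds : Task → Finset Task
  | .hop .live k => (Finset.range k).image (.hop .live)
  | .hop .static k => (Finset.range k).image (.hop .static)
  | .proc => (Finset.range (σ.steps .live).length).image (.hop .live) ∪
      (Finset.range (σ.steps .static).length).image (.hop .static)
  | .hop .output k => insert .proc ((Finset.range (σ.steps .live).length).image (.hop .live) ∪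
      (Finset.range (σ.steps .static).length).image (.hop .static) ∪
        (Finset.range k).image (.hop .output))

/-- A rank that increases along the precedence relation. -/
def rank : Task → ℕ
  | .hop .live k => k
  | .hop .static k => k
  | .proc => (σ.steps .live).length + (σ.steps .static).length
  | .hop .output k => (σ.steps .live).length + (σ.steps .static).length + 1 + k

theorem rank_lt {v w : Task} (h : v ∈ σ.preds w) : σ.rank v < σ.rank w := by
  rcases w with ⟨_ | _ | _, k⟩ | _ <;>
    simp only [preds, Finset.mem_image, Finset.mem_range, Finset.mem_union, Finset.mem_insert] at h
  · obtain ⟨j, hj, rfl⟩ := h; exact hj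
  · obtain ⟨j, hj, rfl⟩ := h; exact hj
  · rcases h with rfl | (⟨j, hj, rfl⟩ | ⟨j, hj, rfl⟩) | ⟨j, hj, rfl⟩ <;> simp only [rank] <;> omega
  · rcases h with ⟨j, hj, rfl⟩ | ⟨j, hj, rfl⟩ <;> simp only [rank] <;> omega

end Route

namespace Control

variable (u : N.Control)

theorem ready_iff {t : ℕ} {c : C} {τ n : ℕ} {w : Task} : u.Ready t c τ n w ↔
    ∀ v ∈ (u.route c τ n).preds w, u.Finished t c τ n v := by
  rcases w with ⟨_ | _ | _, k⟩ | _ <;>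
    simp [Ready, Route.preds, AtEnd, Crossed, or_imp, forall_and, Finset.mem_image]
  tauto

end Control

end Network

/-! ### Balanced sequences -/

/-- A sequence that visits each point of a finite set with a prescribed frequency, up to a bounded
error in the number of visits. -/
theorem exists_balanced_sequence {S : Type*} [Fintype S] (P : S → ℝ) (h0 : ∀ s, 0 ≤ P s)
    (h1 : ∑ s, P s = 1) :
    ∃ f : ℕ → S, ∀ s k, |(Nat.count (fun j => f j = s) k : ℝ) - k * P s| ≤ Fintype.card S := by
  have hne : Nonempty S := by
    by_contra h
    rw [not_nonempty_iff] at h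
    simp at h1
  have hmax : ∀ g : S → ℝ, ∃ s, ∀ r, g r ≤ g s := fun g => Finite.exists_max g
  choose pick hpick using hmax
  -- Greedy rule: `state k s` is the deficit `k * P s` minus the visits to `s`, and the next point
  -- visited has the largest updated deficit.
  let state : ℕ → S → ℝ := fun k => Nat.rec (fun _ => 0)
    (fun _ d => fun s => d s + P s - if s = pick (fun s => d s + P s) then 1 else 0) k
  let f : ℕ → S := fun k => pick fun s => state k s + P s
  have hs : ∀ k s, state (k + 1) s = state k s + P s - if s = f k then 1 else 0 := fun k s => rfl
  have hcount : ∀ k s, state k s = k * P s - Nat.count (fun j => f j = s) k := by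
    intro k
    induction k with
    | zero => intro s; simp [state]
    | succ k ih =>
      intro s
      rw [hs, ih, Nat.count_succ]
      by_cases h : f k = s
      · simp [h]; ring
      · simp [h, Ne.symm h]; ring
  have hsum : ∀ k, ∑ s, state k s = 0 := by
    intro k
    induction k with
    | zero => simp [state]
    | succ k ih => simp [hs, Finset.sum_add_distrib, ih, h1]
  have hlow : ∀ k s, -1 ≤ state k s := by
    intro k
    induction k with
    | zero => intro s; simp [state]
    | succ k ih =>
      intro s
      rw [hs]
      split_ifs with h
      · subst h
        -- The updated deficits sum to `1`, so the largest is nonnegative and drops to no less than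
        -- `-1`. As the deficits sum to `0`, this lower bound also yields the upper bound below.
        have : 0 ≤ state k (f k) + P (f k) := by
          by_contra hneg
          have : ∑ s, (state k s + P s) < 0 := by
            refine Finset.sum_neg (fun s _ => ?_) Finset.univ_nonempty
            exact (hpick (fun s => state k s + P s) s).trans_lt (not_le.1 hneg)
          rw [Finset.sum_add_distrib, hsum, h1] at this
          linarith
        linarith
      · linarith [ih s, h0 s]
  have hcard : (1 : ℝ) ≤ Fintype.card S := by exact_mod_cast Fintype.card_pos
  refine ⟨f, fun s k => ?_⟩
  have e := hcount k s
  have hup : state k s ≤ Fintype.card S := by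
    have h := hsum k
    rw [← Finset.add_sum_erase _ _ (Finset.mem_univ s)] at h
    have h2 : -(Fintype.card S : ℝ) ≤ ∑ r ∈ Finset.univ.erase s, state k r := by
      have := Finset.card_nsmul_le_sum (Finset.univ.erase s) (state k) (-1) fun r _ => hlow k r
      refine le_trans ?_ this
      rw [Finset.card_erase_of_mem (Finset.mem_univ s), Finset.card_univ]
      have : ((Fintype.card S - 1 : ℕ) : ℝ) ≤ Fintype.card S := by
        exact_mod_cast Nat.sub_le _ _
      simp only [nsmul_eq_mul]; linarith
    linarith
  have hl := hlow k s
  rw [abs_le]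
  constructor <;> linarith

/-- Reindexing by the bijection that sends `k` to the point visited and the number of earlier visits
to it. -/
theorem sum_range_count_eq {S : Type*} [Fintype S] (f : ℕ → S) (h : S → ℕ → ℝ) (K : ℕ) :
    ∑ k ∈ Finset.range K, h (f k) (Nat.count (fun j => f j = f k) k)
      = ∑ s, ∑ m ∈ Finset.range (Nat.count (fun j => f j = s) K), h s m := by
  induction K with
  | zero => simp
  | succ K ih =>
    rw [Finset.sum_range_succ, ih]
    have : ∀ s, ∑ m ∈ Finset.range (Nat.count (fun j => f j = s) (K + 1)), h s m
        = ∑ m ∈ Finset.range (Nat.count (fun j => f j = s) K), h s m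
          + if s = f K then h s (Nat.count (fun j => f j = s) K) else 0 := by
      intro s
      rw [Nat.count_succ]
      by_cases hs : f K = s
      · simp [hs, Finset.sum_range_succ]
      · simp [hs, Ne.symm hs]
    simp [this, Finset.sum_add_distrib]

theorem exists_count_eq {p : ℕ → Prop} [DecidablePred p] {m K : ℕ} (h : m < Nat.count p K) :
    ∃ k < K, p k ∧ Nat.count p k = m := by
  induction K with
  | zero => simp at h
  | succ K ih =>
    rw [Nat.count_succ] at h
    by_cases hm : m < Nat.count p K
    · obtain ⟨k, hk, hp⟩ := ih hm
      exact ⟨k, by omega, hp⟩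
    · by_cases hK : p K
      · rw [if_pos hK] at h
        exact ⟨K, by omega, hK, by omega⟩
      · rw [if_neg hK] at h; omega

/-! ### Rate limits -/

/-- This is a server of rate `a` whose cumulative supply `g` also has rate `a`. For `b' < a` the
supply eventually exceeds `b' * (t + 1)`, and from then on `y` stays above a line of slope `b'`. -/
theorem tendsto_div_of_recursion {y g : ℕ → ℝ} {a : ℝ} (hy : ∀ t, y (t + 1) = min (y t + a) (g t))
    (hle : ∀ t, y t ≤ g t) (hg : Tendsto (fun t : ℕ => g t / t) atTop (𝓝 a)) :
    Tendsto (fun t : ℕ => y t / t) atTop (𝓝 a) := by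
  rw [tendsto_order] at hg ⊢
  constructor
  · intro b hb
    obtain ⟨b', hbb, hba⟩ := exists_between hb
    obtain ⟨b'', hbb', hba'⟩ := exists_between hba
    -- The last threshold gives `b' * (t + 1) ≤ b'' * t`, which absorbs the shift by one slot in the
    -- recursion.
    obtain ⟨T, hT⟩ := eventually_atTop.1
      (((hg.1 _ hba').and (eventually_gt_atTop 0)).and
        ((tendsto_natCast_atTop_atTop (R := ℝ)).eventually_ge_atTop (b' / (b'' - b'))))
    have hgT : ∀ t ≥ T, b' * (t + 1) ≤ g t := by
      intro t ht
      obtain ⟨⟨h1, h2⟩, h3⟩ := hT t ht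
      have h2' : (0 : ℝ) < t := by exact_mod_cast h2
      rw [lt_div_iff₀ h2'] at h1
      rw [div_le_iff₀ (by linarith)] at h3
      linarith
    set L := |b' * T - y T|
    have hlow : ∀ t ≥ T, b' * t - L ≤ y t := by
      intro t ht
      induction t, ht using Nat.le_induction with
      | base => linarith [le_abs_self (b' * T - y T)]
      | succ t ht ih =>
        rw [hy, le_min_iff]
        push_cast
        exact ⟨by linarith, by linarith [hgT t ht, abs_nonneg (b' * T - y T)]⟩
    filter_upwards [eventually_ge_atTop T, eventually_gt_atTop 0,
      (tendsto_natCast_atTop_atTop (R := ℝ)).eventually_gt_atTop (L / (b' - b))] with t h1 h2 h3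
    have h2' : (0 : ℝ) < t := by exact_mod_cast h2
    rw [lt_div_iff₀ h2']
    rw [div_lt_iff₀ (by linarith)] at h3
    linarith [hlow t h1]
  · intro b hb
    filter_upwards [hg.2 b hb] with t ht
    exact (div_le_div_of_nonneg_right (hle t) (Nat.cast_nonneg t)).trans_lt ht

theorem tendsto_floor_div {y : ℕ → ℝ} {a : ℝ} (h0 : ∀ t, 0 ≤ y t)
    (hy : Tendsto (fun t : ℕ => y t / t) atTop (𝓝 a)) :
    Tendsto (fun t : ℕ => (⌊y t⌋₊ : ℝ) / t) atTop (𝓝 a) := by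
  refine tendsto_of_tendsto_of_tendsto_of_le_of_le
    (by simpa using hy.sub (tendsto_const_div_atTop_nhds_zero_nat (1 : ℝ))) hy ?_ ?_
  · intro t
    have := div_le_div_of_nonneg_right (c := (t : ℝ))
      (show y t - 1 ≤ ⌊y t⌋₊ by linarith [Nat.lt_floor_add_one (y t)]) (Nat.cast_nonneg t)
    rwa [sub_div, one_div] at this
  · intro t
    exact div_le_div_of_nonneg_right (Nat.floor_le (h0 t)) (Nat.cast_nonneg t)

theorem tendsto_succ_div {x : ℕ → ℝ} {a : ℝ} (hx : Tendsto (fun t : ℕ => x t / t) atTop (𝓝 a)) :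
    Tendsto (fun t : ℕ => x (t + 1) / t) atTop (𝓝 a) := by
  have h1 := hx.comp (tendsto_add_atTop_nat 1)
  have h2 : Tendsto (fun t : ℕ => 1 + (1 : ℝ) / t) atTop (𝓝 1) := by
    simpa using (tendsto_const_div_atTop_nhds_zero_nat (1 : ℝ)).const_add 1
  have h3 := h1.mul h2
  rw [mul_one] at h3
  refine h3.congr' ?_
  filter_upwards [eventually_gt_atTop 0] with t ht
  have : (t : ℝ) ≠ 0 := by exact_mod_cast ht.ne'
  have : (t : ℝ) + 1 ≠ 0 := by positivity
  simp only [Function.comp_apply, Nat.cast_add, Nat.cast_one]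
  field_simp

/-! ### A feed-forward system of queues with constant service rate -/

section Tandem

variable {ι : Type*} (a : ℝ) (arr : ℕ → ℕ) (pred : ι → Finset ι)

/-- The number of jobs that may have been started at station `w` if `n` jobs arrived, and station
`v` has performed the amount `y v` of work. -/
def available (n : ℕ) (y : ι → ℝ) (w : ι) : ℕ :=
  (Finset.insertNone (pred w)).inf' Finset.insertNone_nonempty
    fun o => o.elim n fun v => ⌊y v⌋₊

/-- The amount of work that each station has performed before slot `t` (one unit per job), if
the stations work at rate `a`. -/
def level : ℕ → ι → ℝ
  | 0, _ => 0
  | t + 1, w => min (level t w + a) (available pred (arr t) (level t) w)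

variable {a arr pred}

/-- Jobs are numbered from zero, so job `m` has been finished at station `v` once `y v` reaches `m +
1`. -/
theorem lt_available {n m : ℕ} {y : ι → ℝ} {w : ι} :
    m < available pred n y w ↔ m < n ∧ ∀ v ∈ pred w, (m : ℝ) + 1 ≤ y v := by
  rw [available, Finset.lt_inf'_iff]
  simp only [Finset.mem_insertNone, Option.forall, Option.elim]
  refine and_congr (by simp) ?_
  simp only [Option.mem_def, Option.some.injEq, forall_eq', ← Nat.succ_le_iff]
  refine forall₂_congr fun v _ => ?_
  rw [Nat.le_floor_iff' (Nat.succ_ne_zero m)]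
  push_cast
  rfl

theorem available_le (n : ℕ) (y : ι → ℝ) (w : ι) : available pred n y w ≤ n := by
  by_contra h
  exact lt_irrefl _ (lt_available.1 (not_le.1 h)).1

theorem available_mono {n n' : ℕ} {y y' : ι → ℝ} (hn : n ≤ n') (hy : ∀ v, y v ≤ y' v) (w : ι) :
    available pred n y w ≤ available pred n' y' w := by
  by_contra h
  obtain ⟨h1, h2⟩ := lt_available.1 (not_le.1 h)
  exact lt_irrefl _ (lt_available.2 ⟨h1.trans_le hn, fun v hv => (h2 v hv).trans (hy v)⟩)

theorem level_le_succ (ha : 0 ≤ a) (harr : Monotone arr) (t : ℕ) (w : ι) :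
    level a arr pred t w ≤ level a arr pred (t + 1) w := by
  induction t generalizing w with
  | zero => simp [level, ha]
  | succ t ih =>
    rw [level, level]
    refine min_le_min (by linarith [ih w]) ?_
    exact_mod_cast available_mono (harr t.le_succ) ih w

theorem level_nonneg (ha : 0 ≤ a) (harr : Monotone arr) (t : ℕ) (w : ι) :
    0 ≤ level a arr pred t w := by
  induction t with
  | zero => simp [level]
  | succ t ih => exact ih.trans (level_le_succ ha harr t w)

theorem level_le_available (ha : 0 ≤ a) (harr : Monotone arr) (t : ℕ) (w : ι) :
    level a arr pred t w ≤ available pred (arr t) (level a arr pred t) w := by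
  cases t with
  | zero => simp [level]
  | succ t =>
    refine (min_le_right _ _).trans ?_
    exact_mod_cast available_mono (harr t.le_succ) (level_le_succ ha harr t) w

theorem level_le_arr (ha : 0 ≤ a) (harr : Monotone arr) (t : ℕ) (w : ι) :
    level a arr pred t w ≤ arr t :=
  (level_le_available ha harr t w).trans (by exact_mod_cast available_le _ _ _)

/-- Induction along the precedence order: the numbers of whole jobs finished by the predecessors
have rate `a`, hence so does their minimum with the arrivals, which is the supply in
`tendsto_div_of_recursion`. -/
theorem tendsto_level_div (ha : 0 ≤ a) (harr : Monotone arr) (rank : ι → ℕ)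
    (hrank : ∀ w, ∀ v ∈ pred w, rank v < rank w)
    (hlim : Tendsto (fun t : ℕ => (arr t : ℝ) / t) atTop (𝓝 a)) (w : ι) :
    Tendsto (fun t : ℕ => level a arr pred t w / t) atTop (𝓝 a) := by
  induction hr : rank w using Nat.strong_induction_on generalizing w with
  | _ r ih =>
    refine tendsto_div_of_recursion (fun t => rfl) (fun t => level_le_available ha harr t w) ?_
    have hpred : ∀ v ∈ pred w,
        Tendsto (fun t : ℕ => (⌊level a arr pred t v⌋₊ : ℝ) / t) atTop (𝓝 a) := fun v hv =>
      tendsto_floor_div (level_nonneg ha harr · v) (ih _ (hr ▸ hrank w v hv) v rfl)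
    -- The element `none` stands for the arrivals, so the minimum is never over an empty set.
    have := Tendsto.finset_inf'_nhds_apply (l := atTop) (g := fun _ => a)
      (f := fun (o : Option ι) (t : ℕ) =>
        o.elim ((arr t : ℝ) / t) fun v => (⌊level a arr pred t v⌋₊ : ℝ) / t)
      (s := Finset.insertNone (pred w)) Finset.insertNone_nonempty (by
        rintro (_ | v) hv
        · exact hlim
        · exact hpred v (by simpa using hv))
    rw [Finset.inf'_const] at this
    refine this.congr fun t => ?_
    rw [available, Finset.apply_inf'_eq_inf'_comp Finset.insertNone_nonempty
      (fun n : ℕ => (n : ℝ) / t)]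
    · refine Finset.inf'_congr _ rfl ?_
      rintro (_ | v) _ <;> rfl
    · exact fun x y => Monotone.map_min fun x y hxy =>
        div_le_div_of_nonneg_right (by exact_mod_cast hxy) (Nat.cast_nonneg t)

end Tandem

/-- Truncation of a real number to the unit interval. -/
def unitClamp (x : ℝ) : ℝ := max 0 (min 1 x)

theorem unitClamp_mono : Monotone unitClamp := fun _ _ h => max_le_max le_rfl (min_le_min le_rfl h)

theorem one_le_unitClamp {x : ℝ} : 1 ≤ unitClamp x ↔ 1 ≤ x := by
  simp [unitClamp]

theorem unitClamp_of_nonpos {x : ℝ} (h : x ≤ 0) : unitClamp x = 0 := by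
  simp [unitClamp, h]

theorem unitClamp_of_one_le {x : ℝ} (h : 1 ≤ x) : unitClamp x = 1 := by
  simp [unitClamp, h]

theorem unitClamp_of_mem {x : ℝ} (h0 : 0 ≤ x) (h1 : x ≤ 1) : unitClamp x = x := by
  simp [unitClamp, h0, h1]

/-- When an amount `y` of work is done on unit jobs in order, job `m` has received `unitClamp (y -
m)`. -/
theorem sum_unitClamp {y : ℝ} (hy : 0 ≤ y) (M : ℕ) :
    ∑ m ∈ Finset.range M, unitClamp (y - m) = min y M := by
  induction M with
  | zero => simp [hy]
  | succ M ih =>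
    rw [Finset.sum_range_succ, ih]
    push_cast
    rcases le_total y M with h | h
    · rw [unitClamp_of_nonpos (by linarith), min_eq_left h, min_eq_left (by linarith)]; simp
    · rcases le_total y (M + 1) with h' | h'
      · rw [unitClamp_of_mem (by linarith) (by linarith), min_eq_right h, min_eq_left h']; ring
      · rw [unitClamp_of_one_le (by linarith), min_eq_right h, min_eq_right h']

theorem level_congr {ι : Type*} {a : ℝ} {arr arr' : ℕ → ℕ} {pred : ι → Finset ι} {t : ℕ}
    (h : ∀ s < t, arr s = arr' s) : level a arr pred t = level a arr' pred t := by
  induction t with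
  | zero => rfl
  | succ t ih =>
    funext w
    rw [level, level, ih fun s hs => h s (hs.trans t.lt_succ_self), h t t.lt_succ_self]

theorem sum_range_not_le {y : ℝ} {M : ℕ} (hy : 0 ≤ y) (hM : y ≤ M) :
    ∑ m ∈ Finset.range M, (if (m : ℝ) + 1 ≤ y then (0 : ℝ) else 1) ≤ M - ⌊y⌋₊ := by
  have hf : ⌊y⌋₊ ≤ M := Nat.floor_le_of_le hM
  calc ∑ m ∈ Finset.range M, (if (m : ℝ) + 1 ≤ y then (0 : ℝ) else 1)
      ≤ ∑ m ∈ Finset.range M, (if m ∈ Finset.Ico ⌊y⌋₊ M then (1 : ℝ) else 0) := by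
        refine Finset.sum_le_sum fun m hm => ?_
        by_cases h : (m : ℝ) + 1 ≤ y
        · rw [if_pos h]; split_ifs <;> norm_num
        · rw [if_neg h, if_pos]
          refine Finset.mem_Ico.2 ⟨?_, Finset.mem_range.1 hm⟩
          rw [← Nat.lt_succ_iff, Nat.floor_lt hy]
          push_cast
          exact not_le.1 h
    _ ≤ M - ⌊y⌋₊ := by
        rw [← Finset.sum_filter, Finset.sum_const, nsmul_eq_mul, mul_one, ← Nat.cast_sub hf,
          ← Nat.card_Ico]
        exact_mod_cast Finset.card_le_card fun m hm => (Finset.mem_filter.1 hm).2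

/-- The number of requests of client `c` that arrive before slot `t`. -/
def arrived {C : Type*} (α : ℕ → C → ℕ) (c : C) (t : ℕ) : ℕ := ∑ s ∈ Finset.range t, α s c

section Arrived

variable {C : Type*} {α α' : ℕ → C → ℕ} {c : C}

theorem arrived_succ (t : ℕ) : arrived α c (t + 1) = arrived α c t + α t c :=
  Finset.sum_range_succ _ _

theorem arrived_mono : Monotone (arrived α c) :=
  monotone_nat_of_le_succ fun t => by rw [arrived_succ]; exact Nat.le_add_right _ _

theorem arrived_congr {t : ℕ} (h : ∀ s < t, α s = α' s) : arrived α c t = arrived α' c t :=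
  Finset.sum_congr rfl fun s hs => by rw [h s (Finset.mem_range.1 hs)]

theorem arrived_add_lt {τ n t : ℕ} (hn : n < α τ c) (ht : τ < t) :
    arrived α c τ + n < arrived α c t :=
  calc arrived α c τ + n < arrived α c (τ + 1) := by rw [arrived_succ]; omega
    _ ≤ arrived α c t := arrived_mono ht

/-- The requests of a client are numbered consecutively in order of arrival, `n` within slot `τ`
having number `arrived α c τ + n`. -/
theorem sum_requests (g : ℕ → ℝ) (T : ℕ) :
    ∑ τ ∈ Finset.range T, ∑ n ∈ Finset.range (α τ c), g (arrived α c τ + n)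
      = ∑ k ∈ Finset.range (arrived α c T), g k := by
  induction T with
  | zero => simp [arrived]
  | succ T ih => rw [Finset.sum_range_succ, ih, arrived_succ, Finset.sum_range_add]

theorem exists_request {k T : ℕ} (h : k < arrived α c T) :
    ∃ τ < T, ∃ n < α τ c, k = arrived α c τ + n := by
  induction T with
  | zero => simp [arrived] at h
  | succ T ih =>
    by_cases hk : k < arrived α c T
    · obtain ⟨τ, hτ, hn⟩ := ih hk
      exact ⟨τ, by omega, hn⟩
    · rw [arrived_succ] at h
      exact ⟨T, by omega, k - arrived α c T, by omega, by omega⟩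

end Arrived

/-! ### A control that dedicates a service rate to each route -/

namespace Network

variable {V Φ K C : Type*} {N : Network V Φ K C}

/-- The predecessors of a task that require service. -/
def Route.activePreds {c : C} (σ : N.Route c) (w : Task) : Finset Task :=
  (σ.preds w).filter fun v => σ.taskWork v ≠ 0

section Dedicated

variable (f : (c : C) → ℕ → N.Star c) (a : (c : C) → N.Star c → ℝ) (α : ℕ → C → ℕ)

/-- The route of a request, if the routes of client `c` are assigned according to the sequence
`f c`. -/
def star (c : C) (τ n : ℕ) : N.Star c := f c (arrived α c τ + n)

/-- The number of previous requests of the same client with the same route. -/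
def classIndex (c : C) (τ n : ℕ) : ℕ :=
  Nat.count (fun j => f c j = star f α c τ n) (arrived α c τ + n)

/-- The number of requests with route `σ` that have arrived in slot `t` or before. -/
def classArrived (c : C) (σ : N.Star c) (t : ℕ) : ℕ :=
  Nat.count (fun j => f c j = σ) (arrived α c (t + 1))

/-- The amount of service (in packets) that the packets with route `σ` have received for task `w`
before slot `t`, if rate `a c σ` is dedicated to them at each resource. -/
def progress (c : C) (σ : N.Star c) (t : ℕ) (w : Task) : ℝ :=
  level (a c σ) (classArrived f α c σ) σ.1.activePreds t w

/-- The number of packets with route `σ` for which task `w` was ready in slot `t` or before. -/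
def readyCount (c : C) (σ : N.Star c) (t : ℕ) (w : Task) : ℕ :=
  available σ.1.activePreds (classArrived f α c σ t) (progress f a α c σ t) w

/-- Each resource serves the packets with route `σ` in the order of their arrival, and spends the
rate `a c σ` on them. -/
def dedicatedControl : N.Control where
  route c τ n := (star f α c τ n).1
  serve t c τ n w :=
    if τ ≤ t ∧ n < α τ c then
      (star f α c τ n).1.taskWork w *
        (unitClamp (progress f a α c (star f α c τ n) (t + 1) w - classIndex f α c τ n)
          - unitClamp (progress f a α c (star f α c τ n) t w - classIndex f α c τ n))
    else 0

variable {f a α}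

theorem classArrived_mono (c : C) (σ : N.Star c) : Monotone (classArrived f α c σ) :=
  fun _ _ h => Nat.count_monotone _ (arrived_mono (Nat.add_le_add_right h 1))

theorem classIndex_lt_iff {c : C} {τ n t : ℕ} (hn : n < α τ c) :
    classIndex f α c τ n < classArrived f α c (star f α c τ n) t ↔ τ ≤ t := by
  constructor
  · intro h
    by_contra ht
    refine absurd h (not_lt.2 (Nat.count_monotone _ ?_))
    exact (arrived_mono (show t + 1 ≤ τ by omega)).trans (Nat.le_add_right _ _)
  · exact fun h => Nat.count_strict_mono (p := fun j => f c j = star f α c τ n) rfl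
      (arrived_add_lt hn (Nat.lt_succ_of_le h))

theorem sum_requests_class (c : C) (h : N.Star c → ℕ → ℝ) [Fintype (N.Star c)] (t : ℕ) :
    ∑ τ ∈ Finset.range (t + 1), ∑ n ∈ Finset.range (α τ c),
        h (star f α c τ n) (classIndex f α c τ n)
      = ∑ σ, ∑ m ∈ Finset.range (classArrived f α c σ t), h σ m :=
  (sum_requests (fun k => h (f c k) (Nat.count (fun j => f c j = f c k) k)) (t + 1)).trans
    (sum_range_count_eq (f c) h _)

section

variable (ha : ∀ c σ, 0 ≤ a c σ)
include ha

theorem progress_nonneg (c : C) (σ : N.Star c) (t : ℕ) (w : Task) :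
    0 ≤ progress f a α c σ t w :=
  level_nonneg (ha c σ) (classArrived_mono c σ) t w

theorem progress_le_succ (c : C) (σ : N.Star c) (t : ℕ) (w : Task) :
    progress f a α c σ t w ≤ progress f a α c σ (t + 1) w :=
  level_le_succ (ha c σ) (classArrived_mono c σ) t w

end

end Dedicated

section Dedicated

variable {f : (c : C) → ℕ → N.Star c} {a : (c : C) → N.Star c → ℝ} {α : ℕ → C → ℕ}

theorem progress_succ (c : C) (σ : N.Star c) (t : ℕ) (w : Task) : progress f a α c σ (t + 1) w =
    min (progress f a α c σ t w + a c σ) (readyCount f a α c σ t w) := rfl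

theorem readyCount_le (c : C) (σ : N.Star c) (t : ℕ) (w : Task) :
    readyCount f a α c σ t w ≤ classArrived f α c σ t := available_le _ _ _

variable (ha : ∀ c σ, 0 ≤ a c σ)
include ha

/-- The guard `τ ≤ t` changes nothing for an actual request: before its arrival, the progress of its
class does not exceed its index and both clamps vanish. Without the guard, the service telescopes
over time. -/
theorem serve_dedicatedControl {t : ℕ} {c : C} {τ n : ℕ} (hn : n < α τ c) (w : Task) :
    (dedicatedControl f a α).serve t c τ n w = (star f α c τ n).1.taskWork w *
        (unitClamp (progress f a α c (star f α c τ n) (t + 1) w - classIndex f α c τ n)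
          - unitClamp (progress f a α c (star f α c τ n) t w - classIndex f α c τ n)) := by
  by_cases ht : τ ≤ t
  · exact if_pos ⟨ht, hn⟩
  · have h1 := not_lt.1 (mt (classIndex_lt_iff (f := f) hn).1 ht)
    have h2 : progress f a α c (star f α c τ n) (t + 1) w ≤ classIndex f α c τ n := by
      refine (min_le_right _ _).trans ?_
      exact_mod_cast (readyCount_le _ _ _ _).trans h1
    have h3 := (progress_le_succ (f := f) (α := α) ha c (star f α c τ n) t w).trans h2
    rw [unitClamp_of_nonpos (by linarith), unitClamp_of_nonpos (by linarith), sub_self, mul_zero]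
    exact if_neg fun h => ht h.1

theorem received_dedicatedControl {t : ℕ} {c : C} {τ n : ℕ} (hn : n < α τ c) (w : Task) :
    (dedicatedControl f a α).received t c τ n w = (star f α c τ n).1.taskWork w *
        unitClamp (progress f a α c (star f α c τ n) t w - classIndex f α c τ n) := by
  rw [Control.received, Finset.sum_congr rfl fun s _ => serve_dedicatedControl ha hn w,
    ← Finset.mul_sum, Finset.sum_range_sub
      (fun s => unitClamp (progress f a α c (star f α c τ n) s w - classIndex f α c τ n))]
  have : progress f a α c (star f α c τ n) 0 w = 0 := rfl
  rw [this, unitClamp_of_nonpos (x := 0 - (classIndex f α c τ n : ℝ)) (by simp), sub_zero]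

theorem finished_dedicatedControl {t : ℕ} {c : C} {τ n : ℕ} (hn : n < α τ c) (w : Task) :
    (dedicatedControl f a α).Finished t c τ n w ↔ (star f α c τ n).1.taskWork w = 0 ∨
      (classIndex f α c τ n : ℝ) + 1 ≤ progress f a α c (star f α c τ n) t w := by
  have hw := (star f α c τ n).1.taskWork_nonneg w
  rw [Control.Finished, received_dedicatedControl ha hn]
  change (star f α c τ n).1.taskWork w ≤ _ ↔ _
  rcases hw.eq_or_lt with h | h
  · simp [← h]
  · rw [le_mul_iff_one_le_right h, one_le_unitClamp, or_iff_right h.ne', le_sub_iff_add_le']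

/-- Service in order of arrival makes the pending packets of a class an interval of indices, from
the whole number of finished packets to the number of ready ones. Tasks of zero work are finished
from the outset, which is why only `activePreds` delay a task. -/
theorem pending_dedicatedControl {t : ℕ} {c : C} {τ n : ℕ} (hn : n < α τ c) (w : Task) :
    (dedicatedControl f a α).Pending t c τ n w ↔ (star f α c τ n).1.taskWork w ≠ 0 ∧
      classIndex f α c τ n < readyCount f a α c (star f α c τ n) t w ∧
      ⌊progress f a α c (star f α c τ n) t w⌋₊ ≤ classIndex f α c τ n := by
  have hfl : ⌊progress f a α c (star f α c τ n) t w⌋₊ ≤ classIndex f α c τ n ↔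
      ¬ (classIndex f α c τ n : ℝ) + 1 ≤ progress f a α c (star f α c τ n) t w := by
    rw [← Nat.lt_succ_iff, Nat.floor_lt (progress_nonneg ha _ _ _ _), not_le]
    push_cast
    rfl
  have hready : classIndex f α c τ n < readyCount f a α c (star f α c τ n) t w ↔
      τ ≤ t ∧ (dedicatedControl f a α).Ready t c τ n w := by
    rw [readyCount, lt_available, classIndex_lt_iff hn, Control.ready_iff]
    refine and_congr_right fun _ => ?_
    change _ ↔ ∀ v ∈ (star f α c τ n).1.preds w, _
    simp only [finished_dedicatedControl ha hn, Route.activePreds, Finset.mem_filter]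
    exact forall_congr' fun v => by tauto
  rw [Control.Pending, finished_dedicatedControl ha hn, hready, hfl]
  change τ ≤ t ∧ w ∈ (star f α c τ n).1.tasks ∧ _ ↔ _
  have := (star f α c τ n).1.mem_tasks_of_taskWork_ne_zero (w := w)
  tauto

/-- Summed over a class, the clamp increments give the increment of its progress, at most `a c σ`.
So a class costs a resource at most `a c σ` times its load there. -/
theorem admissible_dedicatedControl [Fintype C] [Finite V]
    (hnode : ∀ i, ∑ c, ∑ σ : N.Star c, a c σ * σ.1.nodeLoad i ≤ N.nodeCap i)
    (hlink : ∀ i j, N.graph.Adj i j →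
      ∑ c, ∑ σ : N.Star c, a c σ * σ.1.linkLoad i j ≤ N.linkCap i j) :
    (dedicatedControl f a α).Admissible α := by
  have hspent : ∀ e t, (dedicatedControl f a α).spent α e t ≤
      ∑ c, ∑ σ : N.Star c, a c σ * σ.1.resourceLoad e := by
    intro e t
    refine Finset.sum_le_sum fun c _ => ?_
    let h : N.Star c → ℕ → ℝ := fun σ m => ∑ w ∈ σ.1.tasks with σ.1.taskResource w = some e,
      σ.1.taskWork w * (unitClamp (progress f a α c σ (t + 1) w - m)
        - unitClamp (progress f a α c σ t w - m))
    have heq : ∀ τ, ∀ n ∈ Finset.range (α τ c),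
        (∑ w ∈ ((dedicatedControl f a α).route c τ n).tasks with
          ((dedicatedControl f a α).route c τ n).taskResource w = some e,
            (dedicatedControl f a α).serve t c τ n w)
          = h (star f α c τ n) (classIndex f α c τ n) := fun τ n hn =>
      Finset.sum_congr rfl fun w _ => serve_dedicatedControl ha (Finset.mem_range.1 hn) w
    rw [Finset.sum_congr rfl fun τ _ => Finset.sum_congr rfl (heq τ), sum_requests_class]
    refine Finset.sum_le_sum fun σ _ => ?_
    rw [Finset.sum_comm, Route.resourceLoad, Finset.mul_sum]
    refine Finset.sum_le_sum fun w _ => ?_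
    rw [← Finset.mul_sum, mul_comm]
    refine mul_le_mul_of_nonneg_right ?_ (σ.1.taskWork_nonneg w)
    have h1 : progress f a α c σ (t + 1) w ≤ classArrived f α c σ t :=
      (min_le_right _ _).trans (by exact_mod_cast readyCount_le c σ t w)
    have h2 : progress f a α c σ (t + 1) w ≤ progress f a α c σ t w + a c σ := min_le_left _ _
    have h3 := progress_le_succ (f := f) (α := α) ha c σ t w
    rw [Finset.sum_sub_distrib, sum_unitClamp (progress_nonneg ha c σ _ w),
      sum_unitClamp (progress_nonneg ha c σ _ w), min_eq_left h1, min_eq_left (h3.trans h1)]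
    linarith
  constructor
  · intro t c τ n w
    by_cases h : τ ≤ t ∧ n < α τ c
    · rw [serve_dedicatedControl ha h.2]
      refine mul_nonneg (Route.taskWork_nonneg _ w) (sub_nonneg.2 (unitClamp_mono ?_))
      linarith [progress_le_succ (f := f) (α := α) ha c (star f α c τ n) t w]
    · exact (if_neg h).ge
  · intro t c τ n w hs
    by_cases h : τ ≤ t ∧ n < α τ c
    · rw [serve_dedicatedControl ha h.2, mul_ne_zero_iff] at hs
      rw [pending_dedicatedControl ha h.2]
      have h3 := progress_le_succ (f := f) (α := α) ha c (star f α c τ n) t w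
      refine ⟨hs.1, ?_, ?_⟩
      -- A packet that is not ready has both clamps equal to `0`; in the next case, a finished
      -- packet has both equal to `1`.
      · by_contra hr
        have hr' : (readyCount f a α c (star f α c τ n) t w : ℝ) ≤ classIndex f α c τ n := by
          exact_mod_cast not_lt.1 hr
        have h2 : progress f a α c (star f α c τ n) (t + 1) w ≤ classIndex f α c τ n :=
          (min_le_right _ _).trans hr'
        refine hs.2 ?_
        rw [unitClamp_of_nonpos (by linarith), unitClamp_of_nonpos (by linarith), sub_self]
      · by_contra hr
        have hr' : (classIndex f α c τ n : ℝ) + 1 ≤ progress f a α c (star f α c τ n) t w := by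
          have h4 := Nat.floor_le (progress_nonneg (f := f) (α := α) ha c (star f α c τ n) t w)
          have h5 : ((classIndex f α c τ n + 1 : ℕ) : ℝ) ≤
            ⌊progress f a α c (star f α c τ n) t w⌋₊ := by exact_mod_cast not_le.1 hr
          push_cast at h5
          linarith
        refine hs.2 ?_
        rw [unitClamp_of_one_le (by linarith), unitClamp_of_one_le (by linarith), sub_self]
    · exact absurd (if_neg h) hs
  · intro t i
    refine (hspent _ t).trans ?_
    simpa only [Route.resourceLoad_node] using hnode i
  · intro t i j hij
    refine (hspent _ t).trans ?_
    simpa only [Route.resourceLoad_star_link] using hlink i j hij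

/-! ### Stability -/

/-- Every queued or waiting packet is charged to an unfinished task of its request. For each class
and task, these number at most the arrivals minus the whole part of the progress, two quantities of
equal rate. -/
theorem rateStable_dedicatedControl [Fintype C] [Finite V]
    (hlim : ∀ c σ, Tendsto (fun t : ℕ => (classArrived f α c σ t : ℝ) / t) atTop (𝓝 (a c σ))) :
    (dedicatedControl f a α).RateStable α := by
  let u := dedicatedControl f a α
  let backlog : ℕ → ℝ := fun t => ∑ c, ∑ σ : N.Star c, ∑ w ∈ σ.1.tasks,
    ((classArrived f α c σ t : ℝ) - ⌊progress f a α c σ t w⌋₊)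
  have hb : Tendsto (fun t : ℕ => backlog t / t) atTop (𝓝 0) := by
    have h : ∀ c, ∀ σ : N.Star c, ∀ w, Tendsto (fun t : ℕ =>
        ((classArrived f α c σ t : ℝ) - ⌊progress f a α c σ t w⌋₊) / t) atTop (𝓝 0) := by
      intro c σ w
      have h1 : Tendsto (fun t : ℕ => progress f a α c σ t w / t) atTop (𝓝 (a c σ)) :=
        tendsto_level_div (ha c σ) (classArrived_mono c σ) σ.1.rank
          (fun w v hv => σ.1.rank_lt (Finset.mem_filter.1 hv).1) (hlim c σ) w
      have h2 := (hlim c σ).sub (tendsto_floor_div (progress_nonneg ha c σ · w) h1)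
      rw [sub_self] at h2
      exact h2.congr fun t => (sub_div _ _ _).symm
    have := tendsto_finsetSum Finset.univ fun c _ => tendsto_finsetSum Finset.univ
      fun (σ : N.Star c) _ => tendsto_finsetSum σ.1.tasks fun w _ => h c σ w
    simp only [Finset.sum_const_zero] at this
    refine this.congr fun t => ?_
    simp only [backlog, Finset.sum_div]
  have hbound : ∀ t, ∑ c, ∑ τ ∈ Finset.range (t + 1), ∑ n ∈ Finset.range (α τ c),
      ∑ w ∈ (u.route c τ n).tasks, (if u.Finished t c τ n w then (0 : ℝ) else 1) ≤ backlog t := by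
    intro t
    refine Finset.sum_le_sum fun c _ => ?_
    let h : N.Star c → ℕ → ℝ := fun σ m => ∑ w ∈ σ.1.tasks,
      if (m : ℝ) + 1 ≤ progress f a α c σ t w then 0 else 1
    have hle : ∀ τ, ∀ n ∈ Finset.range (α τ c),
        (∑ w ∈ (u.route c τ n).tasks, (if u.Finished t c τ n w then (0 : ℝ) else 1))
          ≤ h (star f α c τ n) (classIndex f α c τ n) := by
      intro τ n hn
      refine Finset.sum_le_sum fun w _ => ?_
      have := (finished_dedicatedControl (t := t) (f := f) ha (Finset.mem_range.1 hn) w).2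
      split_ifs with h1 h2 h2
      · exact le_rfl
      · exact zero_le_one
      · exact absurd (this (.inr h2)) h1
      · exact le_rfl
    refine (Finset.sum_le_sum fun τ _ => Finset.sum_le_sum (hle τ)).trans ?_
    rw [sum_requests_class]
    refine Finset.sum_le_sum fun σ _ => ?_
    rw [Finset.sum_comm]
    exact Finset.sum_le_sum fun w _ => sum_range_not_le (progress_nonneg ha c σ t w)
      (level_le_arr (ha c σ) (classArrived_mono c σ) t w)
  have hsqueeze : ∀ q : ℕ → ℕ, (∀ t, (q t : ℝ) ≤ backlog t) →
      Tendsto (fun t : ℕ => (q t : ℝ) / t) atTop (𝓝 0) := fun q hq =>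
    squeeze_zero (fun t => by positivity)
      (fun t => div_le_div_of_nonneg_right (hq t) (Nat.cast_nonneg t)) hb
  refine ⟨fun e => hsqueeze _ fun t => le_trans ?_ (hbound t),
    fun i => hsqueeze _ fun t => le_trans ?_ (hbound t)⟩
  · simp only [Control.queue, Nat.cast_sum]
    refine Finset.sum_le_sum fun c _ => Finset.sum_le_sum fun τ _ => Finset.sum_le_sum fun n _ => ?_
    rw [Finset.card_filter, Nat.cast_sum]
    refine Finset.sum_le_sum fun w _ => ?_
    by_cases hf : u.Finished t c τ n w
    · rw [if_neg fun h => h.2.2.2.2 hf, if_pos hf, Nat.cast_zero]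
    · rw [if_neg hf]; split_ifs <;> simp
  · simp only [Control.waitingQueue, Nat.cast_sum]
    refine Finset.sum_le_sum fun c _ => Finset.sum_le_sum fun τ _ => ?_
    rw [Finset.card_filter, Nat.cast_sum]
    refine Finset.sum_le_sum fun n _ => ?_
    have h0 : ∀ w ∈ (u.route c τ n).tasks,
        (0 : ℝ) ≤ if u.Finished t c τ n w then (0 : ℝ) else 1 := fun w _ => by
      split_ifs <;> norm_num
    split_ifs with h
    · obtain ⟨x, hx⟩ : ∃ x, ¬ u.AtEnd t c τ n x := by
        rcases h.2 with h | h
        · exact ⟨_, h.2⟩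
        · exact ⟨_, h.2⟩
      simp only [Control.AtEnd, Control.Crossed, not_forall] at hx
      obtain ⟨k, hk, hnf⟩ := hx
      refine le_trans ?_ (Finset.single_le_sum h0
        ((Route.mem_tasks _).2 (.inr ⟨x, k, hk, rfl⟩)))
      rw [if_neg hnf, Nat.cast_one]
    · rw [Nat.cast_zero]; exact Finset.sum_nonneg h0

end Dedicated

section Dedicated

variable {f : (c : C) → ℕ → N.Star c} {a : (c : C) → N.Star c → ℝ} {α α' : ℕ → C → ℕ}

/-! ### Causality -/

theorem star_congr {t : ℕ} (h : ∀ s < t, α s = α' s) (c : C) (n : ℕ) :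
    star f α c t n = star f α' c t n := by
  rw [star, star, arrived_congr h]

theorem classIndex_congr {t : ℕ} (h : ∀ s < t, α s = α' s) (c : C) (n : ℕ) :
    classIndex f α c t n = classIndex f α' c t n := by
  rw [classIndex, classIndex, star_congr h, arrived_congr h]

theorem progress_congr {t : ℕ} (h : ∀ s < t, α s = α' s) (c : C) (σ : N.Star c) :
    progress f a α c σ t = progress f a α' c σ t :=
  level_congr fun s hs => by
    rw [classArrived, classArrived, arrived_congr fun r hr => h r (by omega)]

theorem serve_dedicatedControl_congr {t : ℕ} (h : ∀ s ≤ t, α s = α' s) (c : C) (τ n : ℕ)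
    (w : Task) :
    (dedicatedControl f a α).serve t c τ n w = (dedicatedControl f a α').serve t c τ n w := by
  simp only [dedicatedControl]
  by_cases hτ : τ ≤ t
  · rw [h τ hτ, star_congr fun s hs => h s (by omega), classIndex_congr fun s hs => h s (by omega),
      progress_congr fun s hs => h s (by omega), progress_congr fun s hs => h s (by omega)]
  · rw [if_neg fun h => hτ h.1, if_neg fun h => hτ h.1]

/-! ### Distributed scheduling -/

/-- Within a class, the order of service is the lexicographic order of slot and index, both of which
are in the packet header. A queue thus knows this order without knowing the class indices. -/
theorem classIndex_lt_classIndex_iff {c : C} {x y : ℕ × ℕ} (hx : x.2 < α x.1 c)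
    (hy : y.2 < α y.1 c) (h : star f α c x.1 x.2 = star f α c y.1 y.2) :
    classIndex f α c x.1 x.2 < classIndex f α c y.1 y.2 ↔
      x.1 < y.1 ∨ x.1 = y.1 ∧ x.2 < y.2 := by
  have key : ∀ x y : ℕ × ℕ, x.2 < α x.1 c → y.2 < α y.1 c →
      star f α c x.1 x.2 = star f α c y.1 y.2 → (x.1 < y.1 ∨ x.1 = y.1 ∧ x.2 < y.2) →
      classIndex f α c x.1 x.2 < classIndex f α c y.1 y.2 := by
    intro x y hx hy h hlt
    rw [classIndex, classIndex, ← h]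
    refine Nat.count_strict_mono (p := fun j => f c j = star f α c x.1 x.2) rfl ?_
    rcases hlt with hlt | ⟨he, hlt⟩
    · exact (arrived_add_lt hx hlt).trans_le (Nat.le_add_right _ _)
    · rw [he]; omega
  refine ⟨fun hlt => ?_, key x y hx hy h⟩
  by_contra hn
  rcases eq_or_ne x y with rfl | hne
  · exact lt_irrefl _ hlt
  · refine lt_asymm hlt (key y x hy hx h.symm ?_)
    have : ¬ (x.1 = y.1 ∧ x.2 = y.2) := fun h => hne (Prod.ext h.1 h.2)
    omega

/-- The requests with route `ρ` that have a packet waiting for task `w` in a queue. -/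
def queuedRequests {c : C} (S : Set N.QueuedPacket) (ρ : N.Star c) (w : Task) : Set (ℕ × ℕ) :=
  {x | ∃ r, (⟨c, x.1, x.2, w, ρ.1, r⟩ : N.QueuedPacket) ∈ S}

variable (ha : ∀ c σ, 0 ≤ a c σ) {c : C} {ρ : N.Star c} {w : Task} {e : Resource V} {t : ℕ}
include ha

theorem mem_localQueue_dedicatedControl (hw : ρ.1.taskWork w ≠ 0)
    (he : ρ.1.taskResource w = some e) {x : ℕ × ℕ} {r : ℝ} :
    (⟨c, x.1, x.2, w, ρ.1, r⟩ : N.QueuedPacket) ∈ (dedicatedControl f a α).localQueue α e t ↔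
      x.2 < α x.1 c ∧ star f α c x.1 x.2 = ρ ∧
      r = ρ.1.taskWork w * unitClamp (progress f a α c ρ t w - classIndex f α c x.1 x.2) ∧
      classIndex f α c x.1 x.2 < readyCount f a α c ρ t w ∧
      ⌊progress f a α c ρ t w⌋₊ ≤ classIndex f α c x.1 x.2 := by
  change x.2 < α x.1 c ∧ ρ.1 = (star f α c x.1 x.2).1 ∧ _ ∧ _ ∧ ρ.1.taskResource w = some e ↔ _
  constructor
  · rintro ⟨hx, hs, hr, hp, -⟩
    obtain rfl : ρ = star f α c x.1 x.2 := Subtype.ext hs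
    simp only at hr hp
    rw [received_dedicatedControl ha hx] at hr
    rw [pending_dedicatedControl ha hx] at hp
    exact ⟨hx, rfl, hr, hp.2⟩
  · rintro ⟨hx, rfl, hr, hp⟩
    refine ⟨hx, rfl, ?_, (pending_dedicatedControl ha hx w).2 ⟨hw, hp⟩, he⟩
    simp only
    rw [received_dedicatedControl ha hx]
    exact hr

theorem mem_queuedRequests (hw : ρ.1.taskWork w ≠ 0) (he : ρ.1.taskResource w = some e)
    {x : ℕ × ℕ} :
    x ∈ queuedRequests ((dedicatedControl f a α).localQueue α e t) ρ w ↔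
      x.2 < α x.1 c ∧ star f α c x.1 x.2 = ρ ∧
      classIndex f α c x.1 x.2 < readyCount f a α c ρ t w ∧
      ⌊progress f a α c ρ t w⌋₊ ≤ classIndex f α c x.1 x.2 := by
  simp only [queuedRequests, Set.mem_ofPred_eq, mem_localQueue_dedicatedControl ha hw he]
  constructor
  · rintro ⟨r, h1, h2, -, h3⟩; exact ⟨h1, h2, h3⟩
  · rintro ⟨h1, h2, h3⟩; exact ⟨_, h1, h2, rfl, h3⟩

theorem exists_mem_queuedRequests (hw : ρ.1.taskWork w ≠ 0) (he : ρ.1.taskResource w = some e)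
    {m : ℕ} (h1 : ⌊progress f a α c ρ t w⌋₊ ≤ m) (h2 : m < readyCount f a α c ρ t w) :
    ∃ x ∈ queuedRequests ((dedicatedControl f a α).localQueue α e t) ρ w,
      classIndex f α c x.1 x.2 = m := by
  obtain ⟨k, hk, hkρ, hkm⟩ := exists_count_eq (h2.trans_le (readyCount_le c ρ t w))
  obtain ⟨τ, -, n, hn, rfl⟩ := exists_request hk
  have hs : star f α c τ n = ρ := hkρ
  have hi : classIndex f α c τ n = m := by rw [classIndex, hs, hkm]
  exact ⟨(τ, n), (mem_queuedRequests ha hw he).2 ⟨hn, hs, hi ▸ h2, hi ▸ h1⟩, hi⟩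

theorem injOn_classIndex (hw : ρ.1.taskWork w ≠ 0) (he : ρ.1.taskResource w = some e) :
    Set.InjOn (fun x : ℕ × ℕ => classIndex f α c x.1 x.2)
      (queuedRequests ((dedicatedControl f a α).localQueue α e t) ρ w) := by
  intro x hx y hy hxy
  rw [mem_queuedRequests ha hw he] at hx hy
  have h1 := classIndex_lt_classIndex_iff hx.1 hy.1 (hx.2.1.trans hy.2.1.symm)
  have h2 := classIndex_lt_classIndex_iff hy.1 hx.1 (hy.2.1.trans hx.2.1.symm)
  simp only at hxy
  rw [hxy] at h1 h2
  simp only [lt_self_iff_false, false_iff] at h1 h2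
  exact Prod.ext (by omega) (by omega)

theorem ncard_queuedRequests (hw : ρ.1.taskWork w ≠ 0) (he : ρ.1.taskResource w = some e) :
    (queuedRequests ((dedicatedControl f a α).localQueue α e t) ρ w).ncard =
      readyCount f a α c ρ t w - ⌊progress f a α c ρ t w⌋₊ := by
  rw [← (injOn_classIndex ha hw he).ncard_image, ← Nat.card_Ico,
    ← Set.ncard_coe_finset]
  congr 1
  ext m
  simp only [Set.mem_image, Finset.coe_Ico, Set.mem_Ico]
  constructor
  · rintro ⟨x, hx, rfl⟩
    exact ((mem_queuedRequests ha hw he).1 hx).2.2.symm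
  · rintro ⟨h1, h2⟩
    exact exists_mem_queuedRequests ha hw he h1 h2

theorem ncard_queuedRequests_before (hw : ρ.1.taskWork w ≠ 0) (he : ρ.1.taskResource w = some e)
    {x : ℕ × ℕ} (hx : x ∈ queuedRequests ((dedicatedControl f a α).localQueue α e t) ρ w) :
    {y ∈ queuedRequests ((dedicatedControl f a α).localQueue α e t) ρ w |
      y.1 < x.1 ∨ y.1 = x.1 ∧ y.2 < x.2}.ncard =
      classIndex f α c x.1 x.2 - ⌊progress f a α c ρ t w⌋₊ := by
  rw [← ((injOn_classIndex ha hw he).mono fun y hy => hy.1).ncard_image,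
    ← Nat.card_Ico, ← Set.ncard_coe_finset]
  have hx' := (mem_queuedRequests ha hw he).1 hx
  congr 1
  ext m
  simp only [Set.mem_image, Finset.coe_Ico, Set.mem_Ico]
  constructor
  · rintro ⟨y, ⟨hy, hlt⟩, rfl⟩
    have hy' := (mem_queuedRequests ha hw he).1 hy
    exact ⟨hy'.2.2.2,
      (classIndex_lt_classIndex_iff hy'.1 hx'.1 (hy'.2.1.trans hx'.2.1.symm)).2 hlt⟩
  · rintro ⟨h1, h2⟩
    obtain ⟨y, hy, rfl⟩ := exists_mem_queuedRequests ha hw he h1 (h2.trans hx'.2.2.1)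
    have hy' := (mem_queuedRequests ha hw he).1 hy
    exact ⟨y, ⟨hy, (classIndex_lt_classIndex_iff hy'.1 hx'.1
      (hy'.2.1.trans hx'.2.1.symm)).1 h2⟩, rfl⟩

/-- The first queued packet of a class has index `⌊progress⌋₊`, so the service it has received is
its work times the fractional part of the progress. -/
theorem progress_sub_floor_eq (hw : ρ.1.taskWork w ≠ 0) (he : ρ.1.taskResource w = some e)
    (hq : (dedicatedControl f a α).localQueue α e t = (dedicatedControl f a α').localQueue α' e t)
    {x : ℕ × ℕ} (hx : x ∈ queuedRequests ((dedicatedControl f a α).localQueue α e t) ρ w) :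
    progress f a α c ρ t w - ⌊progress f a α c ρ t w⌋₊ =
      progress f a α' c ρ t w - ⌊progress f a α' c ρ t w⌋₊ := by
  have hx' := (mem_queuedRequests ha hw he).1 hx
  obtain ⟨y, hy, hym⟩ := exists_mem_queuedRequests ha hw he le_rfl
    (hx'.2.2.2.trans_lt hx'.2.2.1)
  have hcard := ncard_queuedRequests_before ha hw he hy
  have hy2 := hy
  rw [hq] at hcard hy2
  rw [ncard_queuedRequests_before ha hw he hy2, hym, Nat.sub_self] at hcard
  obtain ⟨r, hr⟩ := hy
  have hr2 := hr
  rw [hq] at hr2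
  rw [mem_localQueue_dedicatedControl ha hw he] at hr hr2
  -- No packet of the class precedes `y` in the common queue, so `y` comes first under `α'` as well.
  have hym' : classIndex f α' c y.1 y.2 = ⌊progress f a α' c ρ t w⌋₊ := by
    have := hr2.2.2.2.2
    omega
  have h := hr.2.2.1.symm.trans hr2.2.2.1
  rw [hym, hym'] at h
  have hclamp : ∀ p : ℝ, 0 ≤ p → unitClamp (p - ⌊p⌋₊) = p - ⌊p⌋₊ := fun p hp =>
    unitClamp_of_mem (sub_nonneg.2 (Nat.floor_le hp)) (by linarith [Nat.lt_floor_add_one p])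
  rw [hclamp _ (progress_nonneg ha _ _ _ _), hclamp _ (progress_nonneg ha _ _ _ _)] at h
  exact mul_left_cancel₀ hw h

/-- Service depends on `progress` and `readyCount` only relative to the packet's own class index.
These differences are determined by the fractional part of the progress, the packet's position and
the number of queued packets of its class and task. -/
theorem serve_eq_of_localQueue_eq (hw : ρ.1.taskWork w ≠ 0) (he : ρ.1.taskResource w = some e)
    (hq : (dedicatedControl f a α).localQueue α e t = (dedicatedControl f a α').localQueue α' e t)
    {x : ℕ × ℕ} (hx : x ∈ queuedRequests ((dedicatedControl f a α).localQueue α e t) ρ w) :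
    (dedicatedControl f a α).serve t c x.1 x.2 w =
      (dedicatedControl f a α').serve t c x.1 x.2 w := by
  have hfr := progress_sub_floor_eq ha hw he hq hx
  have hlen := ncard_queuedRequests (f := f) (α := α) (t := t) ha hw he
  have hpos := ncard_queuedRequests_before ha hw he hx
  have hx2 := hx
  rw [hq] at hx2 hlen hpos
  rw [ncard_queuedRequests ha hw he] at hlen
  rw [ncard_queuedRequests_before ha hw he hx2] at hpos
  rw [mem_queuedRequests ha hw he] at hx hx2
  obtain ⟨h1, h2, h3, h4⟩ := hx
  obtain ⟨h1', h2', h3', h4'⟩ := hx2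
  have e1 : progress f a α c ρ t w - classIndex f α c x.1 x.2 =
      progress f a α' c ρ t w - classIndex f α' c x.1 x.2 := by
    have : (classIndex f α' c x.1 x.2 : ℝ) + ⌊progress f a α c ρ t w⌋₊ =
      classIndex f α c x.1 x.2 + ⌊progress f a α' c ρ t w⌋₊ := by norm_cast; omega
    linarith
  have e2 : (readyCount f a α c ρ t w : ℝ) - classIndex f α c x.1 x.2 =
      readyCount f a α' c ρ t w - classIndex f α' c x.1 x.2 := by
    have : (classIndex f α' c x.1 x.2 : ℝ) + readyCount f a α c ρ t w =
      classIndex f α c x.1 x.2 + readyCount f a α' c ρ t w := by norm_cast; omega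
    linarith
  rw [serve_dedicatedControl ha h1, serve_dedicatedControl ha h1', h2, h2', progress_succ,
    progress_succ, ← min_sub_sub_right, ← min_sub_sub_right, e2, add_sub_right_comm,
    add_sub_right_comm, e1]

end Dedicated

/-! ### The dedicated policy and sufficiency -/

section Policy

variable [Fintype C]

/-- The policy that uses `dedicatedControl`. -/
def dedicatedPolicy (f : (c : C) → ℕ → N.Star c) (a : (c : C) → N.Star c → ℝ)
    (hadm : ∀ α, (dedicatedControl f a α).Admissible α) : N.Policy where
  Seed := Unit
  seedLaw := Measure.dirac ()
  control α _ := dedicatedControl f a α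
  admissible α _ := hadm α
  causal_route _ _ _ _ h c n := congrArg Subtype.val (star_congr (fun s hs => h s hs.le) c n)
  causal_serve _ _ _ _ h c τ n w := serve_dedicatedControl_congr h c τ n w
  measurable_route _ _ _ _ _ := MeasurableSet.of_discrete
  measurable_serve _ _ _ _ _ _ := Measurable.of_discrete

theorem isDistributed_dedicatedPolicy {f : (c : C) → ℕ → N.Star c} {a : (c : C) → N.Star c → ℝ}
    (ha : ∀ c σ, 0 ≤ a c σ) (hadm : ∀ α, (dedicatedControl f a α).Admissible α) :
    (dedicatedPolicy f a hadm).IsDistributed := by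
  rintro θ α α' t e h ⟨c, τ, n, w, σ, r⟩ hp
  have hq : (dedicatedControl f a α).localQueue α e t =
    (dedicatedControl f a α').localQueue α' e t := h t le_rfl
  change (⟨c, τ, n, w, σ, r⟩ : N.QueuedPacket) ∈ (dedicatedControl f a α).localQueue α e t at hp
  have hp' := hp
  obtain ⟨hn, hs, -, hpend, he⟩ := hp'
  simp only at hn hs hpend he
  have hs' : σ = (star f α c τ n).1 := hs
  subst hs'
  rw [pending_dedicatedControl ha hn] at hpend
  exact serve_eq_of_localQueue_eq ha hpend.1 he hq (x := (τ, n)) ⟨r, hp⟩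

theorem ae_tendsto_arrived {Ω : Type*} [MeasurableSpace Ω] {P : Measure Ω}
    {α : ℕ → C → Ω → ℕ} {lam : C → ℝ≥0} (h : IsArrivalProcess P α lam) :
    ∀ᵐ ω ∂P, ∀ c, Tendsto (fun t : ℕ => (arrived (fun t c => α t c ω) c t : ℝ) / t) atTop
      (𝓝 (lam c)) := by
  rw [ae_all_iff]
  intro c
  have hm : Measurable (Nat.cast : ℕ → ℝ) := Measurable.of_discrete
  by_cases hP : IsProbabilityMeasure P
  · obtain ⟨A, hA⟩ := h.bounded c
    have hint : Integrable (fun ω => (α 0 c ω : ℝ)) P := by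
      refine Integrable.of_bound (hm.comp (h.measurable 0 c)).aestronglyMeasurable A ?_
      filter_upwards [hA 0] with ω hω
      simpa using hω
    have := strong_law_ae_real (fun t ω => (α t c ω : ℝ)) hint
      (fun i j hij => ((h.indep c).indepFun hij).comp hm hm)
      (fun t => (h.ident t c).comp hm)
    filter_upwards [this] with ω hω
    rw [h.mean 0 c] at hω
    simpa [arrived] using hω
  · exact absurd (h.indep c).isProbabilityMeasure hP

theorem mem_stabilityRegion_of_load_le [Finite V] {lam : C → ℝ≥0} {P : (c : C) → N.Star c → ℝ}
    (hP : N.IsRouteDistribution P) (hnode : ∀ i, N.avgNodeLoad lam P i ≤ N.nodeCap i)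
    (hlink : ∀ i j, N.graph.Adj i j → N.avgLinkLoad lam P i j ≤ N.linkCap i j) :
    lam ∈ N.stabilityRegion := by
  choose f hf using fun c => exists_balanced_sequence (P c) (hP c).1 (hP c).2
  let a : (c : C) → N.Star c → ℝ := fun c σ => lam c * P c σ
  have ha : ∀ c σ, 0 ≤ a c σ := fun c σ => mul_nonneg (lam c).2 ((hP c).1 σ)
  have hadm : ∀ α, (dedicatedControl f a α).Admissible α := fun α => by
    refine admissible_dedicatedControl ha (fun i => ?_) fun i j hij => ?_
    · simpa only [a, avgNodeLoad, mul_right_comm] using hnode i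
    · simpa only [a, avgLinkLoad, mul_right_comm] using hlink i j hij
  refine ⟨dedicatedPolicy f a hadm, isDistributed_dedicatedPolicy ha hadm, ?_⟩
  intro Ω _ μ _ α hα
  have hq := Measure.quasiMeasurePreserving_fst (μ := μ)
    (ν := (dedicatedPolicy f a hadm).seedLaw)
  filter_upwards [hq.ae (ae_tendsto_arrived hα)] with x hx
  refine rateStable_dedicatedControl ha fun c σ => ?_
  have h1 := (tendsto_succ_div (hx c)).mul_const (P c σ)
  have h2 := tendsto_const_div_atTop_nhds_zero_nat (Fintype.card (N.Star c) : ℝ)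
  -- The bounded discrepancy is divided by `t`, so class arrivals inherit the rate `lam c * P c σ`
  -- from the strong law.
  refine tendsto_of_tendsto_of_dist h1 (squeeze_zero (fun t => dist_nonneg) (fun t => ?_) h2)
  rw [Real.dist_eq, abs_sub_comm, classArrived, div_mul_eq_mul_div, ← sub_div, abs_div,
    Nat.abs_cast]
  exact div_le_div_of_nonneg_right (hf c σ _) (Nat.cast_nonneg t)

end Policy
end Network
instance instFiniteResource {V : Type*} [Finite V] : Finite (Resource V) := by
  refine Finite.of_injective (β := V ⊕ V × V) (fun e => match e with
    | .node i => .inl i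
    | .link i j => .inr (i, j)) ?_
  intro x y h
  cases x <;> cases y <;> simp_all

/-! ### Necessity on a sample path -/

namespace Network

variable {V Φ K C : Type*} {N : Network V Φ K C}

namespace Control

variable (u : N.Control)

/-- A request that is not completed has a packet in a transmission or processing queue. -/
theorem exists_pending (hu : ∀ t c τ n w, 0 ≤ u.serve t c τ n w) {t : ℕ} {c : C} {τ n : ℕ}
    (hτ : τ ≤ t)
    (h : ∃ w ∈ (u.route c τ n).tasks, ¬ u.Finished t c τ n w) :
    ∃ w, u.Pending t c τ n w ∧ ∃ e, (u.route c τ n).taskResource w = some e := by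
  -- An unfinished task of least rank has all predecessors finished, hence is ready.
  obtain ⟨w, ⟨hw, hwf⟩, hmin⟩ := exists_minimalFor_of_wellFoundedLT
    (fun w => w ∈ (u.route c τ n).tasks ∧ ¬ u.Finished t c τ n w) (u.route c τ n).rank h
  have hmem : ∀ v ∈ (u.route c τ n).preds w, v ∈ (u.route c τ n).tasks := by
    intro v hv
    rw [Route.mem_tasks] at hw ⊢
    rcases w with ⟨_ | _ | _, k⟩ | _ <;>
      simp only [Route.preds, Finset.mem_image, Finset.mem_range, Finset.mem_union,
        Finset.mem_insert] at hv <;> grind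
  have hready : u.Ready t c τ n w := by
    rw [ready_iff]
    intro v hv
    by_contra hvf
    have hlt := (u.route c τ n).rank_lt hv
    exact absurd (hmin ⟨hmem v hv, hvf⟩ hlt.le) (not_le.2 hlt)
  refine ⟨w, ⟨hτ, hw, hready, hwf⟩, ?_⟩
  refine Route.taskResource_ne_none _ fun h0 => ?_
  refine hwf (h0.trans_le ?_)
  exact Finset.sum_nonneg fun s _ => hu s c τ n w

/-- All tasks of the request are finished before slot `t`. -/
def Completed (t : ℕ) (c : C) (τ n : ℕ) : Prop :=
  ∀ w ∈ (u.route c τ n).tasks, u.Finished t c τ n w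

variable {u}

theorem sum_not_completed_le [Fintype C] [Fintype (Resource V)] {α : ℕ → C → ℕ}
    (hu : ∀ t c τ n w, 0 ≤ u.serve t c τ n w) (c : C) (T : ℕ) :
    ∑ τ ∈ Finset.range T, ∑ n ∈ Finset.range (α τ c), (if u.Completed T c τ n then (0 : ℝ) else 1)
      ≤ ∑ e, (u.queue α e T : ℝ) := by
  have h0 : ∀ e, ∑ τ ∈ Finset.range T, ∑ n ∈ Finset.range (α τ c),
      ((((u.route c τ n).tasks.filter fun w =>
        (u.route c τ n).taskResource w = some e ∧ u.Pending T c τ n w).card : ℕ) : ℝ)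
      ≤ u.queue α e T := by
    intro e
    have h1 : ∑ τ ∈ Finset.range T, ∑ n ∈ Finset.range (α τ c),
        ((u.route c τ n).tasks.filter fun w =>
          (u.route c τ n).taskResource w = some e ∧ u.Pending T c τ n w).card
        ≤ u.queue α e T := by
      refine le_trans ?_ (Finset.single_le_sum
        (f := fun c => ∑ τ ∈ Finset.range (T + 1), ∑ n ∈ Finset.range (α τ c),
          ((u.route c τ n).tasks.filter fun w =>
            (u.route c τ n).taskResource w = some e ∧ u.Pending T c τ n w).card)
        (fun _ _ => Nat.zero_le _) (Finset.mem_univ c))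
      exact Finset.sum_le_sum_of_subset (Finset.range_subset_range.2 T.le_succ)
    exact_mod_cast h1
  refine le_trans ?_ (Finset.sum_le_sum fun e _ => h0 e)
  rw [Finset.sum_comm]
  refine Finset.sum_le_sum fun τ hτ => ?_
  rw [Finset.sum_comm]
  refine Finset.sum_le_sum fun n _ => ?_
  split_ifs with h
  · exact Finset.sum_nonneg fun e _ => Nat.cast_nonneg _
  · simp only [Completed, not_forall] at h
    obtain ⟨v, hv, hvf⟩ := h
    obtain ⟨w, hp, e, he⟩ := u.exists_pending hu (Finset.mem_range.1 hτ).le ⟨v, hv, hvf⟩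
    have hcard : 0 < ((u.route c τ n).tasks.filter fun w =>
        (u.route c τ n).taskResource w = some e ∧ u.Pending T c τ n w).card :=
      Finset.card_pos.2 ⟨w, Finset.mem_filter.2 ⟨hp.2.1, he, hp⟩⟩
    refine le_trans ?_ (Finset.single_le_sum
      (f := fun e => ((((u.route c τ n).tasks.filter fun w =>
        (u.route c τ n).taskResource w = some e ∧ u.Pending T c τ n w).card : ℕ) : ℝ))
      (fun e _ => Nat.cast_nonneg _) (Finset.mem_univ e))
    exact_mod_cast hcard

/-- The work on completed requests has been done within the service spent. -/
theorem sum_completed_resourceLoad_le [Fintype C] {α : ℕ → C → ℕ} (hu : u.Admissible α)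
    (e : Resource V) (T : ℕ) :
    ∑ c, ∑ τ ∈ Finset.range T, ∑ n ∈ Finset.range (α τ c),
        (if u.Completed T c τ n then (u.route c τ n).resourceLoad e else 0)
      ≤ ∑ s ∈ Finset.range T, u.spent α e s := by
  -- Nothing is served before its arrival, so the range of `τ` can be made independent of `s` and
  -- the sums exchanged.
  have hspent : ∀ s ∈ Finset.range T, u.spent α e s = ∑ c, ∑ τ ∈ Finset.range T,
      ∑ n ∈ Finset.range (α τ c), ∑ w ∈ (u.route c τ n).tasks with
        (u.route c τ n).taskResource w = some e, u.serve s c τ n w := by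
    intro s hs
    refine Finset.sum_congr rfl fun c _ => ?_
    refine Finset.sum_subset (Finset.range_subset_range.2 (Finset.mem_range.1 hs)) ?_
    intro τ _ hτ
    refine Finset.sum_eq_zero fun n _ => Finset.sum_eq_zero fun w _ => by_contra fun h => ?_
    have := (hu.pending s c τ n w h).1
    exact hτ (Finset.mem_range.2 (by omega))
  have hswap : ∑ s ∈ Finset.range T, u.spent α e s = ∑ c, ∑ τ ∈ Finset.range T,
      ∑ n ∈ Finset.range (α τ c), ∑ w ∈ (u.route c τ n).tasks with
        (u.route c τ n).taskResource w = some e, u.received T c τ n w := by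
    rw [Finset.sum_congr rfl hspent, Finset.sum_comm]
    refine Finset.sum_congr rfl fun c _ => ?_
    rw [Finset.sum_comm]
    refine Finset.sum_congr rfl fun τ _ => ?_
    rw [Finset.sum_comm]
    refine Finset.sum_congr rfl fun n _ => ?_
    rw [Finset.sum_comm]
    rfl
  rw [hswap]
  refine Finset.sum_le_sum fun c _ => Finset.sum_le_sum fun τ _ => Finset.sum_le_sum fun n _ => ?_
  split_ifs with h
  · exact Finset.sum_le_sum fun w hw => h w (Finset.mem_filter.1 hw).1
  · exact Finset.sum_nonneg fun w _ => Finset.sum_nonneg fun s _ => hu.nonneg _ _ _ _ _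

end Control

/-- `x` is a limit point of the numbers per slot of completed requests, sorted by the acyclic
reductions of their routes. The incomplete ones are outnumbered by the queued packets and vanish in
the limit, so the full rate `lam c` is accounted for. -/
theorem sum_mul_resourceLoad_le_of_tendsto {u : N.Control} [Finite V] [Fintype C]
    {α : ℕ → C → ℕ} {lam : C → ℝ≥0} (hu : u.Admissible α)
    (hq : ∀ e, Tendsto (fun t : ℕ => (u.queue α e t : ℝ) / t) atTop (𝓝 0))
    (hα : ∀ c, Tendsto (fun t : ℕ => (arrived α c t : ℝ) / t) atTop (𝓝 (lam c))) :
    ∃ x : (c : C) → N.Star c → ℝ, (∀ c σ, 0 ≤ x c σ) ∧ (∀ c, ∑ σ, x c σ = lam c) ∧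
      ∀ e κ, (∀ t, u.spent α e t ≤ κ) → ∑ c, ∑ σ : N.Star c, x c σ * σ.1.resourceLoad e ≤ κ := by
  have : Fintype (Resource V) := Fintype.ofFinite _
  choose S hS using fun c τ n => (u.route c τ n).exists_star_resourceLoad_le
  let X : ℕ → (c : C) → N.Star c → ℝ := fun T c σ =>
    (∑ τ ∈ Finset.range T, ∑ n ∈ Finset.range (α τ c),
      if u.Completed T c τ n ∧ S c τ n = σ then (1 : ℝ) else 0) / T
  have hX0 : ∀ T c σ, 0 ≤ X T c σ := fun T c σ => div_nonneg
    (Finset.sum_nonneg fun τ _ => Finset.sum_nonneg fun n _ => by split_ifs <;> norm_num)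
    (Nat.cast_nonneg T)
  have hind : ∀ (T : ℕ) c τ n (g : N.Star c → ℝ),
      ∑ σ, (if u.Completed T c τ n ∧ S c τ n = σ then (1 : ℝ) else 0) * g σ
        = if u.Completed T c τ n then g (S c τ n) else 0 := by
    intro T c τ n g
    by_cases h : u.Completed T c τ n <;> simp [h]
  have hXg : ∀ T c (g : N.Star c → ℝ), ∑ σ, X T c σ * g σ =
      (∑ τ ∈ Finset.range T, ∑ n ∈ Finset.range (α τ c),
        if u.Completed T c τ n then g (S c τ n) else 0) / T := by
    intro T c g
    simp only [X, div_mul_eq_mul_div]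
    rw [← Finset.sum_div]
    congr 1
    simp only [Finset.sum_mul]
    rw [Finset.sum_comm]
    refine Finset.sum_congr rfl fun τ _ => ?_
    rw [Finset.sum_comm]
    exact Finset.sum_congr rfl fun n _ => hind T c τ n g
  have hsum : ∀ T c, ∑ σ, X T c σ = ((arrived α c T : ℝ) - ∑ τ ∈ Finset.range T,
      ∑ n ∈ Finset.range (α τ c), if u.Completed T c τ n then (0 : ℝ) else 1) / T := by
    intro T c
    have h1 := hXg T c fun _ => 1
    simp only [mul_one] at h1
    rw [h1]
    congr 1
    have h2 : (arrived α c T : ℝ) = ∑ τ ∈ Finset.range T, ∑ n ∈ Finset.range (α τ c), (1 : ℝ) := by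
      simp [arrived]
    rw [h2, ← Finset.sum_sub_distrib]
    refine Finset.sum_congr rfl fun τ _ => ?_
    rw [← Finset.sum_sub_distrib]
    exact Finset.sum_congr rfl fun n _ => by split_ifs <;> norm_num
  have hlim : ∀ c, Tendsto (fun T => ∑ σ, X T c σ) atTop (𝓝 (lam c)) := by
    intro c
    have h1 : Tendsto (fun T : ℕ => (∑ e, (u.queue α e T : ℝ)) / T) atTop (𝓝 0) := by
      have := tendsto_finsetSum Finset.univ fun e _ => hq e
      simpa [Finset.sum_div] using this
    have h2 : Tendsto (fun T : ℕ => (∑ τ ∈ Finset.range T, ∑ n ∈ Finset.range (α τ c),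
        if u.Completed T c τ n then (0 : ℝ) else 1) / T) atTop (𝓝 0) := by
      refine squeeze_zero (fun T => ?_) (fun T => div_le_div_of_nonneg_right
        (Control.sum_not_completed_le hu.nonneg c T) (Nat.cast_nonneg T)) h1
      exact div_nonneg (Finset.sum_nonneg fun τ _ => Finset.sum_nonneg fun n _ => by
        split_ifs <;> norm_num) (Nat.cast_nonneg T)
    have h3 := (hα c).sub h2
    rw [sub_zero] at h3
    refine h3.congr fun T => ?_
    rw [hsum, sub_div]
  choose M hM using fun c => (hlim c).bddAbove_range
  have hmem : ∀ T, X T ∈ Set.Icc (0 : (c : C) → N.Star c → ℝ) fun c _ => M c := fun T =>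
    ⟨fun c σ => hX0 T c σ, fun c σ =>
      (Finset.single_le_sum (fun σ _ => hX0 T c σ) (Finset.mem_univ σ)).trans
        (hM c (Set.mem_range_self T))⟩
  obtain ⟨x, hx, φ, hφ, hxφ⟩ := isCompact_Icc.tendsto_subseq hmem
  have hxc : ∀ c σ, Tendsto (fun k => X (φ k) c σ) atTop (𝓝 (x c σ)) := fun c σ =>
    tendsto_pi_nhds.1 (tendsto_pi_nhds.1 hxφ c) σ
  refine ⟨x, fun c σ => hx.1 c σ, fun c => ?_, fun e κ hκ => ?_⟩
  · exact tendsto_nhds_unique (tendsto_finsetSum _ fun σ _ => hxc c σ)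
      ((hlim c).comp hφ.tendsto_atTop)
  · have h1 : Tendsto (fun k => ∑ c, ∑ σ : N.Star c, X (φ k) c σ * σ.1.resourceLoad e) atTop
        (𝓝 (∑ c, ∑ σ : N.Star c, x c σ * σ.1.resourceLoad e)) :=
      tendsto_finsetSum _ fun c _ => tendsto_finsetSum _ fun σ _ => (hxc c σ).mul_const _
    have h2 : ∀ T : ℕ, 0 < T → ∑ c, ∑ σ : N.Star c, X T c σ * σ.1.resourceLoad e ≤ κ := by
      intro T hT
      rw [Finset.sum_congr rfl fun c _ => hXg T c fun σ => σ.1.resourceLoad e, ← Finset.sum_div,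
        div_le_iff₀ (by exact_mod_cast hT)]
      calc _ ≤ ∑ c, ∑ τ ∈ Finset.range T, ∑ n ∈ Finset.range (α τ c),
            (if u.Completed T c τ n then (u.route c τ n).resourceLoad e else 0) := by
            refine Finset.sum_le_sum fun c _ => Finset.sum_le_sum fun τ _ =>
              Finset.sum_le_sum fun n _ => ?_
            split_ifs
            · exact hS c τ n e
            · exact le_rfl
        _ ≤ ∑ s ∈ Finset.range T, u.spent α e s := Control.sum_completed_resourceLoad_le hu e T
        _ ≤ ∑ s ∈ Finset.range T, κ := Finset.sum_le_sum fun s _ => hκ s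
        _ = κ * T := by simp [mul_comm]
    refine le_of_tendsto h1 ?_
    filter_upwards [hφ.tendsto_atTop.eventually_gt_atTop 0] with k hk
    exact h2 _ hk

/-- If the queues are rate stable on a sample path, the arrival rates can be supported. -/
theorem exists_routeDistribution_of_rateStable {u : N.Control} [Finite V] [Fintype C]
    {α : ℕ → C → ℕ} {lam : C → ℝ≥0} (hu : u.Admissible α) (hst : u.RateStable α)
    (hα : ∀ c, Tendsto (fun t : ℕ => (arrived α c t : ℝ) / t) atTop (𝓝 (lam c))) :
    ∃ P : (c : C) → N.Star c → ℝ, N.IsRouteDistribution P ∧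
      (∀ i, N.avgNodeLoad lam P i ≤ N.nodeCap i) ∧
      (∀ i j, N.graph.Adj i j → N.avgLinkLoad lam P i j ≤ N.linkCap i j) := by
  obtain ⟨x, hx0, hx1, hxe⟩ := sum_mul_resourceLoad_le_of_tendsto hu hst.1 hα
  -- A client of rate zero needs a distribution too. The control assigns a route even to the index
  -- `(0, 0)`, and its reduction carries a point mass.
  choose ρ _ using fun c => (u.route c 0 0).exists_star_resourceLoad_le
  let P : (c : C) → N.Star c → ℝ := fun c σ =>
    if lam c = 0 then (if σ = ρ c then 1 else 0) else x c σ / lam c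
  have hP : ∀ c (g : N.Star c → ℝ) σ, 0 ≤ g σ → lam c * g σ * P c σ ≤ x c σ * g σ := by
    intro c g σ hg
    by_cases h : lam c = 0
    · simp only [h, NNReal.coe_zero, zero_mul]; exact mul_nonneg (hx0 c σ) hg
    · have h' : (lam c : ℝ) ≠ 0 := by exact_mod_cast h
      simp only [P, if_neg h]
      field_simp
      exact le_rfl
  refine ⟨P, fun c => ⟨fun σ => ?_, ?_⟩, fun i => ?_, fun i j hij => ?_⟩
  · simp only [P]
    split_ifs
    · exact zero_le_one
    · exact le_rfl
    · exact div_nonneg (hx0 c σ) (lam c).2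
  · by_cases h : lam c = 0
    · simp [P, h]
    · have h' : (lam c : ℝ) ≠ 0 := by exact_mod_cast h
      simp only [P, if_neg h]
      rw [← Finset.sum_div, hx1, div_self h']
  · refine le_trans ?_ (hxe (.node i) _ fun t => hu.node_le t i)
    refine Finset.sum_le_sum fun c _ => Finset.sum_le_sum fun σ _ => ?_
    rw [← Route.resourceLoad_node]
    exact hP c (fun σ => σ.1.resourceLoad (.node i)) σ (σ.1.resourceLoad_nonneg _)
  · refine le_trans ?_ (hxe (.link i j) _ fun t => hu.link_le t i j hij)
    refine Finset.sum_le_sum fun c _ => Finset.sum_le_sum fun σ _ => ?_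
    rw [← Route.resourceLoad_star_link]
    exact hP c (fun σ => σ.1.resourceLoad (.link i j)) σ (σ.1.resourceLoad_nonneg _)

theorem exists_routeDistribution_of_stabilizes [Finite V] [Fintype C] {lam : C → ℝ≥0}
    {Ω : Type*} [MeasurableSpace Ω] {μ : Measure Ω} [IsProbabilityMeasure μ]
    {α : ℕ → C → Ω → ℕ} (hα : IsArrivalProcess μ α lam) {π : N.Policy} (hπ : π.Stabilizes μ α) :
    ∃ P : (c : C) → N.Star c → ℝ, N.IsRouteDistribution P ∧
      (∀ i, N.avgNodeLoad lam P i ≤ N.nodeCap i) ∧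
      (∀ i j, N.graph.Adj i j → N.avgLinkLoad lam P i j ≤ N.linkCap i j) := by
  have hq := Measure.quasiMeasurePreserving_fst (μ := μ) (ν := π.seedLaw)
  obtain ⟨x, hx1, hx2⟩ := (hπ.and (hq.ae (ae_tendsto_arrived hα))).exists
  exact exists_routeDistribution_of_rateStable (π.admissible _ _) hx1 hx2

/-! ### Existence of arrival processes -/

theorem exists_isArrivalProcess {C : Type*} (lam : C → ℝ≥0) :
    ∃ (Ω : Type) (_ : MeasurableSpace Ω) (μ : Measure Ω) (α : ℕ → C → Ω → ℕ),
      IsProbabilityMeasure μ ∧ IsArrivalProcess μ α lam := by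
  -- The integer part of the mean plus a Bernoulli variable for the fractional part. All clients may
  -- share one uniform variable per slot, since independence is required only over time.
  let g : C → unitInterval → ℕ := fun c x =>
    ⌊lam c⌋₊ + if (x : ℝ) < lam c - ⌊lam c⌋₊ then 1 else 0
  have hg : ∀ c, Measurable (g c) := fun c => by
    refine measurable_const.add (Measurable.ite ?_ measurable_const measurable_const)
    exact measurableSet_lt measurable_subtype_coe measurable_const
  let μ : Measure (ℕ → unitInterval) := Measure.infinitePi fun _ => volume
  have hident : ∀ t, μ.map (fun ω => ω t) = volume := fun t =>
    (measurePreserving_eval_infinitePi (fun _ : ℕ => (volume : Measure unitInterval)) t).map_eq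
  have hmeas : ∀ t : ℕ, Measurable fun ω : ℕ → unitInterval => ω t := fun t => measurable_pi_apply t
  refine ⟨ℕ → unitInterval, inferInstance, μ, fun t c ω => g c (ω t), inferInstance, ?_⟩
  constructor
  · exact fun t c => (hg c).comp (hmeas t)
  · intro c
    exact iIndepFun_infinitePi (P := fun _ : ℕ => (volume : Measure unitInterval))
      (X := fun _ => g c) fun _ => hg c
  · intro t c
    have : IdentDistrib (fun ω : ℕ → unitInterval => ω t) (fun ω => ω 0) μ μ :=
      ⟨(hmeas t).aemeasurable, (hmeas 0).aemeasurable, by rw [hident, hident]⟩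
    exact this.comp (hg c)
  · intro c
    refine ⟨⌊lam c⌋₊ + 1, fun t => ae_of_all _ fun ω => ?_⟩
    simp only [g]
    split_ifs <;> omega
  · intro t c
    have hm : Measurable (Nat.cast : ℕ → ℝ) := Measurable.of_discrete
    have h1 : ∫ ω, (g c (ω t) : ℝ) ∂μ = ∫ x, (g c x : ℝ) := by
      rw [← hident t]
      exact (integral_map (hmeas t).aemeasurable (hm.comp (hg c)).aestronglyMeasurable).symm
    rw [h1]
    set p : ℝ := lam c - ⌊lam c⌋₊ with hp
    have hp0 : 0 ≤ p := sub_nonneg.2 (by exact_mod_cast Nat.floor_le (zero_le (a := lam c)))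
    have hp1 : p ≤ 1 := by
      have : (lam c : ℝ) < ⌊lam c⌋₊ + 1 := by exact_mod_cast Nat.lt_floor_add_one (lam c)
      linarith
    have h2 : ∀ x : unitInterval, (g c x : ℝ) =
        ⌊lam c⌋₊ + (Set.Iio (⟨p, hp0, hp1⟩ : unitInterval)).indicator (fun _ => (1 : ℝ)) x := by
      intro x
      simp only [g, ← hp, Set.indicator, Set.mem_Iio, ← Subtype.coe_lt_coe]
      push_cast
      rfl
    simp only [h2]
    rw [integral_add (integrable_const _) ((integrable_const _).indicator measurableSet_Iio),
      integral_indicator measurableSet_Iio]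
    simp only [integral_const, probReal_univ, smul_eq_mul, one_mul, mul_one,
      measureReal_restrict_apply_univ]
    rw [Measure.real, unitInterval.volume_Iio, ENNReal.toReal_ofReal hp0]
    linarith

/-! ### Characterization of the region and of its interior -/

variable {V Φ K C : Type*} {N : Network V Φ K C} [Finite V] [Fintype C] {lam : C → ℝ≥0}

theorem exists_routeDistribution_of_mem_stabilityRegion (h : lam ∈ N.stabilityRegion) :
    ∃ P : (c : C) → N.Star c → ℝ, N.IsRouteDistribution P ∧
      (∀ i, N.avgNodeLoad lam P i ≤ N.nodeCap i) ∧
      (∀ i j, N.graph.Adj i j → N.avgLinkLoad lam P i j ≤ N.linkCap i j) := by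
  obtain ⟨π, -, hπ⟩ := h
  obtain ⟨Ω, _, μ, α, _, hα⟩ := exists_isArrivalProcess lam
  exact exists_routeDistribution_of_stabilizes hα (hπ Ω μ α hα)

theorem eventually_avg_lt {P : (c : C) → N.Star c → ℝ} (ℓ : (c : C) → N.Star c → ℝ) {κ : ℝ}
    (h : ∑ c, ∑ σ, (lam c : ℝ) * ℓ c σ * P c σ < κ) :
    ∀ᶠ lam' : C → ℝ≥0 in 𝓝 lam, ∑ c, ∑ σ, (lam' c : ℝ) * ℓ c σ * P c σ < κ := by
  have hcont : Continuous fun lam' : C → ℝ≥0 => ∑ c, ∑ σ, (lam' c : ℝ) * ℓ c σ * P c σ := by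
    fun_prop
  exact hcont.continuousAt.eventually_lt continuousAt_const h

/-- Raising all rates by `ε` adds `ε` times the sum of `ℓ c σ * P c σ`. If this sum is positive
there is slack; if it is zero, the load itself is zero and below the positive capacity. -/
theorem avg_lt_of_add_le {P : (c : C) → N.Star c → ℝ} (hP : N.IsRouteDistribution P)
    {ℓ : (c : C) → N.Star c → ℝ} (hℓ : ∀ c σ, 0 ≤ ℓ c σ) {κ ε : ℝ} (hκ : 0 < κ) (hε : 0 < ε)
    (h : ∑ c, ∑ σ, ((lam c : ℝ) + ε) * ℓ c σ * P c σ ≤ κ) :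
    ∑ c, ∑ σ, (lam c : ℝ) * ℓ c σ * P c σ < κ := by
  have hsplit : ∑ c, ∑ σ, ((lam c : ℝ) + ε) * ℓ c σ * P c σ =
      ∑ c, ∑ σ, (lam c : ℝ) * ℓ c σ * P c σ + ε * ∑ c, ∑ σ, ℓ c σ * P c σ := by
    simp only [Finset.mul_sum, ← Finset.sum_add_distrib]
    exact Finset.sum_congr rfl fun c _ => Finset.sum_congr rfl fun σ _ => by ring
  have h0 : ∀ c, ∀ σ : N.Star c, 0 ≤ ℓ c σ * P c σ := fun c σ => mul_nonneg (hℓ c σ) ((hP c).1 σ)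
  have h1 : 0 ≤ ∑ c, ∑ σ, ℓ c σ * P c σ :=
    Finset.sum_nonneg fun c _ => Finset.sum_nonneg fun σ _ => h0 c σ
  rcases h1.eq_or_lt with h2 | h2
  · have h3 : ∀ c, ∀ σ : N.Star c, ℓ c σ * P c σ = 0 := fun c σ =>
      (Finset.sum_eq_zero_iff_of_nonneg fun σ _ => h0 c σ).1
        ((Finset.sum_eq_zero_iff_of_nonneg fun c _ => Finset.sum_nonneg fun σ _ => h0 c σ).1
          h2.symm c (Finset.mem_univ c)) σ (Finset.mem_univ σ)
    simpa [mul_assoc, h3] using hκ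
  · have := mul_pos hε h2
    linarith

theorem mem_interior_stabilityRegion_iff : lam ∈ interior N.stabilityRegion ↔
    ∃ P : (c : C) → N.Star c → ℝ, N.IsRouteDistribution P ∧
      (∀ i, N.avgNodeLoad lam P i < N.nodeCap i) ∧
      (∀ i j, N.graph.Adj i j → N.avgLinkLoad lam P i j < N.linkCap i j) := by
  rw [mem_interior_iff_mem_nhds]
  constructor
  · intro h
    have hcont : Continuous fun ε : ℝ≥0 => fun c => lam c + ε := by fun_prop
    have h0 : ∀ᶠ ε : ℝ≥0 in 𝓝 0, (fun c => lam c + ε) ∈ N.stabilityRegion :=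
      hcont.continuousAt.eventually_mem (by simpa using h)
    -- Adding the same `ε` to every coordinate stays in the region for small `ε`; the punctured
    -- filter provides a positive one.
    obtain ⟨ε, hε, hε0⟩ := ((h0.filter_mono nhdsWithin_le_nhds).and
      (self_mem_nhdsWithin (s := Set.Ioi (0 : ℝ≥0)))).exists
    obtain ⟨P, hP, h1, h2⟩ := exists_routeDistribution_of_mem_stabilityRegion hε
    refine ⟨P, hP, fun i => ?_, fun i j hij => ?_⟩
    · refine avg_lt_of_add_le (ε := ε) hP (fun c σ => ?_) (N.nodeCap_pos i) hε0 ?_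
      · rw [← Route.resourceLoad_node]; exact σ.1.resourceLoad_nonneg _
      · simpa [avgNodeLoad] using h1 i
    · refine avg_lt_of_add_le (ε := ε) hP (fun c σ => ?_) (N.linkCap_pos i j hij) hε0 ?_
      · rw [← Route.resourceLoad_star_link]; exact σ.1.resourceLoad_nonneg _
      · simpa [avgLinkLoad] using h2 i j hij
  · rintro ⟨P, hP, h1, h2⟩
    have e1 : ∀ᶠ lam' in 𝓝 lam, ∀ i, N.avgNodeLoad lam' P i < N.nodeCap i :=
      eventually_all.2 fun i => eventually_avg_lt _ (h1 i)
    have e2 : ∀ᶠ lam' in 𝓝 lam, ∀ i j, N.graph.Adj i j →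
        N.avgLinkLoad lam' P i j < N.linkCap i j :=
      eventually_all.2 fun i => eventually_all.2 fun j => by
        by_cases hij : N.graph.Adj i j
        · filter_upwards [eventually_avg_lt _ (h2 i j hij)] with lam' h _ using h
        · exact Eventually.of_forall fun _ h => absurd h hij
    filter_upwards [e1, e2] with lam' h1 h2
    exact mem_stabilityRegion_of_load_le hP (fun i => (h1 i).le) fun i j hij => (h2 i j hij).le

end Network
end EdgeCloud
end

theorem theorem1 {V Φ K C : Type*} [Finite V] [Fintype C] (N : EdgeCloud.Network V Φ K C)
    (lam : C → ℝ≥0) :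
    (lam ∈ N.stabilityRegion ↔
      ∃ P : (c : C) → N.Star c → ℝ, N.IsRouteDistribution P ∧
        (∀ i, N.avgNodeLoad lam P i ≤ N.nodeCap i) ∧
        (∀ i j, N.graph.Adj i j → N.avgLinkLoad lam P i j ≤ N.linkCap i j)) ∧
    (lam ∈ interior N.stabilityRegion ↔
      ∃ P : (c : C) → N.Star c → ℝ, N.IsRouteDistribution P ∧
        (∀ i, N.avgNodeLoad lam P i < N.nodeCap i) ∧
        (∀ i j, N.graph.Adj i j → N.avgLinkLoad lam P i j < N.linkCap i j)) ∧
    (∀ (Ω : Type) [MeasurableSpace Ω] (μ : MeasureTheory.Measure Ω)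
      [MeasureTheory.IsProbabilityMeasure μ] (a : ℕ → C → Ω → ℕ),
      EdgeCloud.IsArrivalProcess μ a lam →
        (∃ π : N.Policy, π.Stabilizes μ a) → lam ∈ N.stabilityRegion) := by
  have hsuff : (∃ P : (c : C) → N.Star c → ℝ, N.IsRouteDistribution P ∧
        (∀ i, N.avgNodeLoad lam P i ≤ N.nodeCap i) ∧
        (∀ i j, N.graph.Adj i j → N.avgLinkLoad lam P i j ≤ N.linkCap i j)) →
      lam ∈ N.stabilityRegion := fun ⟨_, hP, h1, h2⟩ =>
    EdgeCloud.Network.mem_stabilityRegion_of_load_le hP h1 h2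
  refine ⟨⟨EdgeCloud.Network.exists_routeDistribution_of_mem_stabilityRegion, hsuff⟩,
    EdgeCloud.Network.mem_interior_stabilityRegion_iff, ?_⟩
  rintro Ω _ μ _ a ha ⟨π, hπ⟩
  exact hsuff (EdgeCloud.Network.exists_routeDistribution_of_stabilizes ha hπ)
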